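/- Let $T>0$, $A\in\mathbb{R}^{N\times N}$, $B\in\mathbb{R}^{N\times q}$, $x_0\in\mathbb{R}^N$, let $Q\in\mathbb{R}^{N\times N}$ be symmetric positive semi-definite, $R\in\mathbb{R}^{q\times q}$ symmetric positive definite, and $x_d\in L^2(0,T;\mathbb{R}^N)$. For $u\in L^2(0,T;\mathbb{R}^q)$ put $$J(u)=\tfrac12\int_0^T\big((x(t)-x_d(t))^\top Q\,(x(t)-x_d(t))+u(t)^\top R\,u(t)\big)\,dt,\qquad \dot x(t)=Ax(t)+Bu(t),\quad x(0)=x_0 .$$ Let $A=\sum_{m=1}^M A_m$, where each $A_m\in\mathbb{R}^{N\times N}$ is dissipative, i.e. $\langle x,A_mx\rangle\le 0$ for all $x\in\mathbb{R}^N$. To each subset $S\subseteq\{1,\dots,M\}$ assign a probability $p_S\ge 0$, with $\sum_S p_S=1$, such that $\pi_m:=\sum_{S\ni m}p_S>0$ for every $m$. Let $0=t_0<t_1<\dots<t_K=T$ be a grid and $h=\max_k(t_k-t_{k-1})$. In each interval $[t_{k-1},t_k)$ a subset $\omega_k$ is selected, independently of the others, with probabilities $p_S$; write $\boldsymbol\omega=(\omega_1,\dots,\omega_K)$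 and let $\mathbb{E}[X]=\sum_{\boldsymbol\omega}X(\boldsymbol\omega)\prod_{k=1}^Kp_{\omega_k}$. Put $$\mathcal A_h(\boldsymbol\omega,t)=\sum_{m\in\omega_k}\frac{A_m}{\pi_m}\quad(t\in[t_{k-1},t_k)),\qquad \mathrm{Var}[\mathcal A]=\sum_{S}\Big\|\sum_{m\in S}\frac{A_m}{\pi_m}-A\Big\|^2p_S,$$ where $\|\cdot\|$ is the operator norm induced by the Euclidean norm, and let $J_h(\boldsymbol\omega,u)$ be defined as $J(u)$, but with the state equation replaced by $\dot x_h(\boldsymbol\omega,t)=\mathcal A_h(\boldsymbol\omega,t)x_h(\boldsymbol\omega,t)+Bu(t)$, $x_h(\boldsymbol\omega,0)=x_0$, and $x$ replaced by $x_h(\boldsymbol\omega,\cdot)$. Then there is a constant $C$ that depends only on $A,B,x_0,Q,R,x_d,T$ (and not on the submatrices $A_m$ or their number, the probabilities, the grid, or $\alpha$) with the following property. Let $\alpha\ge 0$ be such that for every $\boldsymbol\omega$ the functional $J_h(\boldsymbol\omega,\cdot)$ is $\alpha$-convex on $L^2(0,T;\mathbb{R}^q)$, i.e. $$J_h(\boldsymbol\omega,(1-\theta)u+\theta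 v)\le(1-\theta)J_h(\boldsymbol\omega,u)+\theta J_h(\boldsymbol\omega,v)-\tfrac{\alpha}{2}\theta(1-\theta)|u-v|_{L^2}^2\qquad(u,v\in L^2(0,T;\mathbb{R}^q),\ \theta\in[0,1]).$$ Let $u^*$ be the minimizer of $J$, and for each $\boldsymbol\omega$ let $u_h^*(\boldsymbol\omega)$ be the minimizer of $J_h(\boldsymbol\omega,\cdot)$, over $L^2(0,T;\mathbb{R}^q)$. Then $$\alpha^2\,\mathbb{E}\big[\,|J(u_h^*)-J(u^*)|\,\big]\le C\,h\,\mathrm{Var}[\mathcal A].$$ -/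

import Mathlib

open MeasureTheory Set

noncomputable section

namespace RandomBatch

/-! ### Matrices as operators between Euclidean spaces -/

/-- The operator `x ↦ Mx` between Euclidean spaces given by a real matrix `M`.
Its norm `‖op M‖` is the operator norm induced by the Euclidean norms. -/
def op {m n : ℕ} (M : Matrix (Fin m) (Fin n) ℝ) :
    EuclideanSpace ℝ (Fin n) →L[ℝ] EuclideanSpace ℝ (Fin m) :=
  LinearMap.toContinuousLinearMap (Matrix.toEuclideanLin M)

/-! ### Controls, trajectories and cost functionals -/

/-- The space of controls `L²(0,T; ℝ^q)`. -/
abbrev Control (T : ℝ) (q : ℕ) : Type :=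
  Lp (EuclideanSpace ℝ (Fin q)) 2 (volume.restrict (Ioc 0 T))

/-- `x` solves `x'(t) = F(t) x(t) + B u(t)`, `x(0) = x₀` on `[0,T]`, in the (Carathéodory) sense
appropriate for integrable `u`: `x` is continuous, the right-hand side is integrable and `x` is
its integral. -/
structure IsTrajectory {N q : ℕ} (F : ℝ → Matrix (Fin N) (Fin N) ℝ)
    (B : Matrix (Fin N) (Fin q) ℝ) (x₀ : EuclideanSpace ℝ (Fin N)) (T : ℝ)
    (u : ℝ → EuclideanSpace ℝ (Fin q)) (x : ℝ → EuclideanSpace ℝ (Fin N)) : Prop where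
  continuousOn : ContinuousOn x (Icc 0 T)
  integrable : IntervalIntegrable (fun s => op (F s) (x s) + op B (u s)) volume 0 T
  eq_integral : ∀ t ∈ Icc 0 T, x t = x₀ + ∫ s in (0 : ℝ)..t, (op (F s) (x s) + op B (u s))

/-- The trajectory on `[0,T]` of the system `x' = F x + B u`, `x(0) = x₀`. That it exists and is
unique on `[0,T]` for the coefficients considered here is shown below. -/
def trajectory {N q : ℕ} (F : ℝ → Matrix (Fin N) (Fin N) ℝ)
    (B : Matrix (Fin N) (Fin q) ℝ) (x₀ : EuclideanSpace ℝ (Fin N)) (T : ℝ)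
    (u : ℝ → EuclideanSpace ℝ (Fin q)) : ℝ → EuclideanSpace ℝ (Fin N) :=
  Classical.epsilon (IsTrajectory F B x₀ T u)

/-- The quadratic cost
`½ ∫₀ᵀ ((x(t) - x_d(t))ᵀ Q (x(t) - x_d(t)) + u(t)ᵀ R u(t)) dt`
of a control `u`, where `x` is the trajectory of `x' = F x + B u`, `x(0) = x₀`. -/
def cost {N q : ℕ} (F : ℝ → Matrix (Fin N) (Fin N) ℝ)
    (B : Matrix (Fin N) (Fin q) ℝ) (x₀ : EuclideanSpace ℝ (Fin N))
    (Q : Matrix (Fin N) (Fin N) ℝ) (R : Matrix (Fin q) (Fin q) ℝ)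
    (xd : ℝ → EuclideanSpace ℝ (Fin N)) (T : ℝ) (u : Control T q) : ℝ :=
  (1 / 2) * ∫ t in (0 : ℝ)..T,
    (inner ℝ (trajectory F B x₀ T u t - xd t) (op Q (trajectory F B x₀ T u t - xd t))
      + inner ℝ (u t) (op R (u t)))

/-- The cost functional `J` of the original system with constant system matrix `A`. -/
def J {N q : ℕ} (A : Matrix (Fin N) (Fin N) ℝ)
    (B : Matrix (Fin N) (Fin q) ℝ) (x₀ : EuclideanSpace ℝ (Fin N))
    (Q : Matrix (Fin N) (Fin N) ℝ) (R : Matrix (Fin q) (Fin q) ℝ)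
    (xd : ℝ → EuclideanSpace ℝ (Fin N)) (T : ℝ) : Control T q → ℝ :=
  cost (fun _ => A) B x₀ Q R xd T

/-! ### The randomized splitting -/

/-- The probability `π_m` that the index `m` lies in the selected subset, when the subset `S` of
the index set is selected with probability `p S`. -/
def inclusionProb {M : ℕ} (p : Finset (Fin M) → ℝ) (m : Fin M) : ℝ :=
  ∑ S : Finset (Fin M) with m ∈ S, p S

/-- The matrix `∑_{m ∈ S} A_m / π_m` used when the subset `S` is selected. -/
def subsetMatrix {N M : ℕ} (Asub : Fin M → Matrix (Fin N) (Fin N) ℝ)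
    (p : Finset (Fin M) → ℝ) (S : Finset (Fin M)) : Matrix (Fin N) (Fin N) ℝ :=
  ∑ m ∈ S, (inclusionProb p m)⁻¹ • Asub m

/-- `Var[𝒜] = ∑_S ‖∑_{m ∈ S} A_m / π_m - A‖² p_S`. -/
def varA {N M : ℕ} (A : Matrix (Fin N) (Fin N) ℝ) (Asub : Fin M → Matrix (Fin N) (Fin N) ℝ)
    (p : Finset (Fin M) → ℝ) : ℝ :=
  ∑ S : Finset (Fin M), ‖op (subsetMatrix Asub p S - A)‖ ^ 2 * p S

/-- `τ` is a temporal grid `0 = τ 0 < τ 1 < ⋯ < τ K = T`. -/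
structure IsGrid (T : ℝ) {K : ℕ} (τ : Fin (K + 1) → ℝ) : Prop where
  zero : τ 0 = 0
  last : τ (Fin.last K) = T
  strictMono : StrictMono τ

/-- The maximal step size `h` of a grid. -/
def gridSpacing {K : ℕ} (τ : Fin (K + 1) → ℝ) : ℝ :=
  ⨆ k : Fin K, (τ k.succ - τ k.castSucc)

/-- The sample space: in each of the `K` time intervals one subset of the `M` indices is
selected. -/
abbrev Sample (M K : ℕ) : Type := Fin K → Finset (Fin M)

/-- The expectation when the subsets are selected independently, each with probabilities `p`. -/
def expectation {M K : ℕ} (p : Finset (Fin M) → ℝ) (X : Sample M K → ℝ) : ℝ :=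
  ∑ ω : Sample M K, X ω * ∏ k, p (ω k)

/-- The piecewise constant random matrix `𝒜_h(ω,t)`, equal to `∑_{m ∈ ω k} A_m / π_m` on the
`k`-th interval of the grid (and to `0` outside `[0,T)`). -/
def randomMatrix {N M K : ℕ} (Asub : Fin M → Matrix (Fin N) (Fin N) ℝ)
    (p : Finset (Fin M) → ℝ) (τ : Fin (K + 1) → ℝ) (ω : Sample M K) (t : ℝ) :
    Matrix (Fin N) (Fin N) ℝ :=
  ∑ k : Fin K, (Ico (τ k.castSucc) (τ k.succ)).indicator
    (fun _ => subsetMatrix Asub p (ω k)) t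

/-- The cost functional `J_h(ω, ·)` of the randomized system. -/
def Jh {N q M K : ℕ} (Asub : Fin M → Matrix (Fin N) (Fin N) ℝ)
    (p : Finset (Fin M) → ℝ) (τ : Fin (K + 1) → ℝ)
    (B : Matrix (Fin N) (Fin q) ℝ) (x₀ : EuclideanSpace ℝ (Fin N))
    (Q : Matrix (Fin N) (Fin N) ℝ) (R : Matrix (Fin q) (Fin q) ℝ)
    (xd : ℝ → EuclideanSpace ℝ (Fin N)) (T : ℝ) (ω : Sample M K) : Control T q → ℝ :=
  cost (randomMatrix Asub p τ ω) B x₀ Q R xd T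

/-! ### Trajectories exist and are unique -/

theorem IsTrajectory.eqOn {N q : ℕ} {F : ℝ → Matrix (Fin N) (Fin N) ℝ}
    {B : Matrix (Fin N) (Fin q) ℝ} {x₀ : EuclideanSpace ℝ (Fin N)} {T : ℝ}
    {u : ℝ → EuclideanSpace ℝ (Fin q)} {x y : ℝ → EuclideanSpace ℝ (Fin N)} {C : ℝ}
    (hC : ∀ s, ‖op (F s)‖ ≤ C)
    (hx : IsTrajectory F B x₀ T u x) (hy : IsTrajectory F B x₀ T u y) :
    EqOn x y (Icc 0 T) := by
  have hC0 : 0 ≤ C := (norm_nonneg _).trans (hC 0)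
  set d : ℝ → ℝ := fun s => ‖x s - y s‖ with hd
  have hdc : ContinuousOn d (Icc 0 T) := (hx.continuousOn.sub hy.continuousOn).norm
  have hdi : ∀ t ∈ Icc 0 T, IntervalIntegrable d volume 0 t := fun t ht =>
    (hdc.mono (by rw [uIcc_of_le ht.1]; exact Icc_subset_Icc_right ht.2)).intervalIntegrable
  set g : ℝ → ℝ := fun t => ∫ s in (0 : ℝ)..t, d s with hg
  have hbound : ∀ t ∈ Icc 0 T, d t ≤ C * g t := by
    intro t ht
    have hsub : uIcc 0 t ⊆ uIcc 0 T := by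
      rw [uIcc_of_le ht.1, uIcc_of_le (ht.1.trans ht.2)]; exact Icc_subset_Icc_right ht.2
    have e : x t - y t = ∫ s in (0 : ℝ)..t, op (F s) (x s - y s) := by
      rw [hx.eq_integral t ht, hy.eq_integral t ht, add_sub_add_left_eq_sub,
        ← intervalIntegral.integral_sub (hx.integrable.mono_set hsub)
          (hy.integrable.mono_set hsub)]
      congr 1; ext1 s; rw [map_sub]; abel
    rw [hd, hg]; simp only
    rw [e, ← intervalIntegral.integral_const_mul]
    refine intervalIntegral.norm_integral_le_of_norm_le ht.1 ?_ ((hdi t ht).const_mul C)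
    exact Filter.Eventually.of_forall fun s _ =>
      ((op (F s)).le_opNorm _).trans (mul_le_mul_of_nonneg_right (hC s) (norm_nonneg _))
  intro t ht
  have hT : (0 : ℝ) ≤ T := ht.1.trans ht.2
  have hg0 : ∀ s ∈ Icc 0 T, 0 ≤ g s := fun s hs =>
    intervalIntegral.integral_nonneg hs.1 fun _ _ => norm_nonneg _
  have key := norm_le_gronwallBound_of_norm_deriv_right_le (f := g) (f' := d) (δ := 0)
    (K := C) (ε := 0) (a := 0) (b := T)
    (by
      have := intervalIntegral.continuousOn_primitive_interval'
        (hdi T ⟨hT, le_rfl⟩) (left_mem_uIcc)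
      rwa [uIcc_of_le hT] at this)
    (by
      intro s hs
      have hmem : Icc 0 T ∈ nhdsWithin s (Ici s) :=
        Filter.mem_of_superset (Icc_mem_nhdsGE hs.2) (Icc_subset_Icc_left hs.1)
      have hcs : ContinuousWithinAt d (Ici s) s :=
        ((hdc s ⟨hs.1, hs.2.le⟩).mono_of_mem_nhdsWithin hmem)
      have hmeas : StronglyMeasurableAtFilter d (nhdsWithin s (Ioi s)) volume :=
        ⟨Icc 0 T, nhdsWithin_mono _ Ioi_subset_Ici_self hmem,
          hdc.aestronglyMeasurable measurableSet_Icc⟩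
      exact intervalIntegral.integral_hasDerivWithinAt_right (hdi s ⟨hs.1, hs.2.le⟩)
        hmeas (hcs.mono Ioi_subset_Ici_self))
    (by simp [hg])
    (by
      intro s hs
      have hs' : s ∈ Icc 0 T := ⟨hs.1, hs.2.le⟩
      rw [add_zero, Real.norm_of_nonneg (norm_nonneg _), Real.norm_of_nonneg (hg0 s hs')]
      exact hbound s hs') t ht
  have hgt : g t ≤ 0 := by
    have := (le_abs_self (g t)).trans key
    simpa [gronwallBound_ε0] using this
  have hdt : d t ≤ 0 := (hbound t ht).trans (mul_nonpos_of_nonneg_of_nonpos hC0 hgt)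
  exact sub_eq_zero.1 (norm_le_zero_iff.1 hdt)

theorem exp_smul_mul_exp_neg_smul {E : Type*} [NormedRing E] [NormedAlgebra ℝ E]
    [CompleteSpace E] (r : ℝ) (a : E) :
    NormedSpace.exp (r • a) * NormedSpace.exp ((-1 * r) • a) = 1 := by
  let _ : NormedAlgebra ℚ E := NormedAlgebra.restrictScalars ℚ ℝ E
  rw [← NormedSpace.exp_add_of_commute, ← add_smul]
  · simp
  · exact ((Commute.refl a).smul_left _).smul_right _

theorem IsTrajectory.extend {N q : ℕ} {F : ℝ → Matrix (Fin N) (Fin N) ℝ}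
    {B : Matrix (Fin N) (Fin q) ℝ} {x₀ : EuclideanSpace ℝ (Fin N)} {a b : ℝ}
    {u : ℝ → EuclideanSpace ℝ (Fin q)} {x : ℝ → EuclideanSpace ℝ (Fin N)}
    (hx : IsTrajectory F B x₀ a u x) (ha : 0 ≤ a) (hab : a ≤ b)
    (M : Matrix (Fin N) (Fin N) ℝ) (hF : ∀ s ∈ Ico a b, F s = M)
    (hu : IntervalIntegrable u volume 0 b) :
    ∃ y, IsTrajectory F B x₀ b u y := by
  let _ : NormedAlgebra ℚ (EuclideanSpace ℝ (Fin N) →L[ℝ] EuclideanSpace ℝ (Fin N)) :=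
    NormedAlgebra.restrictScalars ℚ ℝ _
  set L := op M with hL
  have hBu : IntervalIntegrable (fun s => op B (u s)) volume a b := by
    have h1 : IntervalIntegrable u volume a b :=
      hu.mono_set (by rw [uIcc_of_le hab, uIcc_of_le (ha.trans hab)]; exact Icc_subset_Icc_left ha)
    exact ⟨(op B).integrable_comp h1.1, (op B).integrable_comp h1.2⟩
  -- extend the input by zero, so that its primitive is continuous everywhere
  set w : ℝ → EuclideanSpace ℝ (Fin N) := (Ioc a b).indicator (fun s => op B (u s)) with hw
  have hwi : Integrable w := by
    rw [hw, integrable_indicator_iff measurableSet_Ioc]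
    exact (intervalIntegrable_iff_integrableOn_Ioc_of_le hab).1 hBu
  set G : ℝ → EuclideanSpace ℝ (Fin N) := fun t => ∫ s in a..t, w s with hG
  have hGc : Continuous G := intervalIntegral.continuous_primitive
    (fun _ _ => hwi.intervalIntegrable) a
  set c : ℝ → EuclideanSpace ℝ (Fin N) := fun t => L (x a + G t) with hc
  have hcc : Continuous c := L.continuous.comp (continuous_const.add hGc)
  have hE : ∀ r : ℝ, Continuous fun t : ℝ => NormedSpace.exp ((r * (t - a)) • L) := by
    intro r
    exact NormedSpace.exp_continuous.comp (by fun_prop)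
  set k : ℝ → EuclideanSpace ℝ (Fin N) :=
    fun t => ∫ s in a..t, NormedSpace.exp ((-1 * (s - a)) • L) (c s) with hk
  have hkc : Continuous fun s => NormedSpace.exp ((-1 * (s - a)) • L) (c s) :=
    (hE (-1)).clm_apply hcc
  set z : ℝ → EuclideanSpace ℝ (Fin N) :=
    fun t => NormedSpace.exp ((t - a) • L) (k t) with hz
  have hzd : ∀ t, HasDerivAt z (L (z t) + c t) t := by
    intro t
    have h1 : HasDerivAt k (NormedSpace.exp ((-1 * (t - a)) • L) (c t)) t :=
      hkc.integral_hasStrictDerivAt a t |>.hasDerivAt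
    have h2 : HasDerivAt (fun s : ℝ => NormedSpace.exp ((s - a) • L))
        (L * NormedSpace.exp ((t - a) • L)) t := by
      have := (hasDerivAt_exp_smul_const' (𝕂 := ℝ) L (t - a)).scomp t
        ((hasDerivAt_id t).sub_const a)
      simpa [Function.comp_def] using this
    have h3 := h2.clm_apply h1
    have h4 : NormedSpace.exp ((t - a) • L) (NormedSpace.exp ((-1 * (t - a)) • L) (c t)) = c t := by
      have : NormedSpace.exp ((t - a) • L) * NormedSpace.exp ((-1 * (t - a)) • L) = 1 :=
        exp_smul_mul_exp_neg_smul (t - a) L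
      have := congrArg (fun f => f (c t)) this
      simpa using this
    rw [h4] at h3
    exact h3
  have hzc : Continuous z := continuous_iff_continuousAt.2 fun t => (hzd t).continuousAt
  have hza : z a = 0 := by simp [hz, hk]
  set v : ℝ → EuclideanSpace ℝ (Fin N) := fun t => x a + G t + z t with hv
  have hvc : Continuous v := (continuous_const.add hGc).add hzc
  have hva : v a = x a := by simp [hv, hza, hG]
  have hveq : ∀ t ∈ Icc a b, v t = x a + ∫ s in a..t, (L (v s) + op B (u s)) := by
    intro t ht
    have e1 : z t = ∫ s in a..t, L (v s) := by
      have hh : ∀ s, L (z s) + c s = L (v s) := by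
        intro s; simp only [hc, hv]; rw [← map_add]; congr 1; abel
      have := intervalIntegral.integral_eq_sub_of_hasDerivAt (f := z) (a := a) (b := t)
        (f' := fun s => L (v s)) (fun s _ => by rw [← hh s]; exact hzd s)
        ((L.continuous.comp hvc).intervalIntegrable _ _)
      rw [this, hza, sub_zero]
    have e2 : G t = ∫ s in a..t, op B (u s) := by
      refine intervalIntegral.integral_congr_ae (Filter.Eventually.of_forall fun s hs => ?_)
      rw [uIoc_of_le ht.1] at hs
      have hs' : s ∈ Ioc a b := ⟨hs.1, hs.2.trans ht.2⟩
      simp only [hw, indicator_of_mem hs']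
    have hBt : IntervalIntegrable (fun s => op B (u s)) volume a t :=
      hBu.mono_set (by rw [uIcc_of_le ht.1, uIcc_of_le hab]; exact Icc_subset_Icc_right ht.2)
    have hLv : IntervalIntegrable (fun s => L (v s)) volume a t :=
      (L.continuous.comp hvc).intervalIntegrable _ _
    rw [intervalIntegral.integral_add hLv hBt, ← e1, ← e2]
    simp only [hv]; abel
  set y : ℝ → EuclideanSpace ℝ (Fin N) := fun t => if t ≤ a then x t else v t with hy
  have hyv : ∀ t, a ≤ t → y t = v t := by
    intro t ht
    by_cases h : t ≤ a
    · have : t = a := le_antisymm h ht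
      subst this; simp [hy, hva]
    · simp [hy, h]
  have hyx : ∀ t, t ≤ a → y t = x t := fun t ht => by simp [hy, ht]
  have hcongr1 : ∀ t ∈ Icc 0 a, EqOn (fun s => op (F s) (x s) + op B (u s))
      (fun s => op (F s) (y s) + op B (u s)) (uIoc 0 t) := by
    intro t ht s hs
    rw [uIoc_of_le ht.1] at hs
    simp only [hyx s (hs.2.trans ht.2)]
  have hne : ∀ᵐ s : ℝ, s ≠ b := by simp [ae_iff]
  have hcongr2 : ∀ t ∈ Icc a b, ∀ᵐ s : ℝ, s ∈ uIoc a t →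
      L (v s) + op B (u s) = op (F s) (y s) + op B (u s) := by
    intro t ht
    filter_upwards [hne] with s hsb hs
    rw [uIoc_of_le ht.1] at hs
    rw [hyv s hs.1.le, hF s ⟨hs.1.le, lt_of_le_of_ne (hs.2.trans ht.2) hsb⟩]
  have hint1 : IntervalIntegrable (fun s => op (F s) (y s) + op B (u s)) volume 0 a :=
    hx.integrable.congr (hcongr1 a ⟨ha, le_rfl⟩)
  have hint2 : IntervalIntegrable (fun s => op (F s) (y s) + op B (u s)) volume a b := by
    have h0 : IntervalIntegrable (fun s => L (v s) + op B (u s)) volume a b :=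
      ((L.continuous.comp hvc).intervalIntegrable _ _).add hBu
    refine h0.congr_ae ?_
    rw [Filter.EventuallyEq, ae_restrict_iff' measurableSet_uIoc]
    exact hcongr2 b ⟨hab, le_rfl⟩
  refine ⟨y, ?_, hint1.trans hint2, ?_⟩
  · rw [← Icc_union_Icc_eq_Icc ha hab]
    refine ContinuousOn.union_of_isClosed ?_ ?_ isClosed_Icc isClosed_Icc
    · exact hx.continuousOn.congr fun t ht => hyx t ht.2
    · exact hvc.continuousOn.congr fun t ht => hyv t ht.1
  · intro t ht
    rcases le_total t a with h | h
    · rw [hyx t h, hx.eq_integral t ⟨ht.1, h⟩]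
      congr 1
      exact intervalIntegral.integral_congr_ae
        (Filter.Eventually.of_forall fun s hs => hcongr1 t ⟨ht.1, h⟩ hs)
    · have hint2t := hint2.mono_set (c := a) (d := t)
        (by rw [uIcc_of_le h, uIcc_of_le hab]; exact Icc_subset_Icc_right ht.2)
      rw [hyv t h, hveq t ⟨h, ht.2⟩, ← intervalIntegral.integral_add_adjacent_intervals hint1
        hint2t, hx.eq_integral a ⟨ha, le_rfl⟩, add_assoc]
      congr 2
      · exact intervalIntegral.integral_congr_ae
          (Filter.Eventually.of_forall fun s hs => hcongr1 a ⟨ha, le_rfl⟩ hs)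
      · exact intervalIntegral.integral_congr_ae (hcongr2 t ⟨h, ht.2⟩)

theorem IsTrajectory.initial {N q : ℕ} (F : ℝ → Matrix (Fin N) (Fin N) ℝ)
    (B : Matrix (Fin N) (Fin q) ℝ) (x₀ : EuclideanSpace ℝ (Fin N))
    (u : ℝ → EuclideanSpace ℝ (Fin q)) : IsTrajectory F B x₀ 0 u (fun _ => x₀) where
  continuousOn := continuousOn_const
  integrable := IntervalIntegrable.refl
  eq_integral := by
    intro t ht
    have : t = 0 := le_antisymm ht.2 ht.1
    simp [this]

theorem Control.intervalIntegrable {T : ℝ} (hT : 0 ≤ T) {q : ℕ} (u : Control T q) :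
    IntervalIntegrable u volume 0 T := by
  rw [intervalIntegrable_iff_integrableOn_Ioc_of_le hT]
  exact (Lp.memLp u).integrable (by norm_num)

/-- The trajectory of the original system is its solution on `[0,T]`. -/
theorem isTrajectory_const {N q : ℕ} (A : Matrix (Fin N) (Fin N) ℝ)
    (B : Matrix (Fin N) (Fin q) ℝ) (x₀ : EuclideanSpace ℝ (Fin N)) {T : ℝ} (hT : 0 ≤ T)
    (u : Control T q) :
    IsTrajectory (fun _ => A) B x₀ T u (trajectory (fun _ => A) B x₀ T u) :=
  Classical.epsilon_spec ((IsTrajectory.initial _ B x₀ u).extend le_rfl hT A (fun _ _ => rfl)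
    (Control.intervalIntegrable hT u))

theorem randomMatrix_eq {N M K : ℕ} (Asub : Fin M → Matrix (Fin N) (Fin N) ℝ)
    (p : Finset (Fin M) → ℝ) {τ : Fin (K + 1) → ℝ} (hτ : StrictMono τ) (ω : Sample M K)
    (k : Fin K) {t : ℝ} (ht : t ∈ Ico (τ k.castSucc) (τ k.succ)) :
    randomMatrix Asub p τ ω t = subsetMatrix Asub p (ω k) := by
  unfold randomMatrix
  rw [Finset.sum_eq_single k]
  · exact indicator_of_mem ht _
  · intro j _ hj
    refine indicator_of_notMem (fun h => ?_) _
    rcases lt_or_gt_of_ne hj with hlt | hlt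
    · have : τ j.succ ≤ τ k.castSucc := hτ.monotone (by
        rw [Fin.le_def]; simpa using hlt)
      exact absurd h.2 (not_lt.2 (this.trans ht.1))
    · have : τ k.succ ≤ τ j.castSucc := hτ.monotone (by
        rw [Fin.le_def]; simpa using hlt)
      exact absurd ht.2 (not_lt.2 (this.trans h.1))
  · simp

/-- The trajectory of the randomized system is its solution on `[0,T]`. -/
theorem isTrajectory_randomMatrix {N q M K : ℕ} (Asub : Fin M → Matrix (Fin N) (Fin N) ℝ)
    (p : Finset (Fin M) → ℝ) {τ : Fin (K + 1) → ℝ} {T : ℝ} (hτ : IsGrid T τ) (ω : Sample M K)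
    (B : Matrix (Fin N) (Fin q) ℝ) (x₀ : EuclideanSpace ℝ (Fin N)) (u : Control T q) :
    IsTrajectory (randomMatrix Asub p τ ω) B x₀ T u
      (trajectory (randomMatrix Asub p τ ω) B x₀ T u) := by
  have hpos : ∀ k, 0 ≤ τ k := fun k => hτ.zero ▸ hτ.strictMono.monotone (Fin.zero_le k)
  have hle : ∀ k, τ k ≤ T := fun k => hτ.last ▸ hτ.strictMono.monotone (Fin.le_last k)
  have hT : 0 ≤ T := (hpos 0).trans (hle 0)
  have hu := Control.intervalIntegrable hT u
  have main : ∀ k : Fin (K + 1), ∃ x, IsTrajectory (randomMatrix Asub p τ ω) B x₀ (τ k) u x := by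
    intro k
    induction k using Fin.induction with
    | zero => rw [hτ.zero]; exact ⟨_, IsTrajectory.initial _ B x₀ u⟩
    | succ k ih =>
      obtain ⟨x, hx⟩ := ih
      refine hx.extend (hpos _) (hτ.strictMono.monotone (Fin.castSucc_le_succ k))
        (subsetMatrix Asub p (ω k))
        (fun s hs => randomMatrix_eq Asub p hτ.strictMono ω k hs) (hu.mono_set ?_)
      rw [uIcc_of_le (hpos _), uIcc_of_le hT]
      exact Icc_subset_Icc_right (hle _)
  have := main (Fin.last K)
  rw [hτ.last] at this
  exact Classical.epsilon_spec this

theorem exists_norm_randomMatrix_le {N M K : ℕ} (Asub : Fin M → Matrix (Fin N) (Fin N) ℝ)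
    (p : Finset (Fin M) → ℝ) (τ : Fin (K + 1) → ℝ) (ω : Sample M K) :
    ∃ C, ∀ t, ‖op (randomMatrix Asub p τ ω t)‖ ≤ C := by
  refine ⟨∑ k : Fin K, ‖op (subsetMatrix Asub p (ω k))‖, fun t => ?_⟩
  have : op (randomMatrix Asub p τ ω t) = ∑ k : Fin K, op ((Ico (τ k.castSucc) (τ k.succ)).indicator
    (fun _ => subsetMatrix Asub p (ω k)) t) := by
    simp [op, randomMatrix]
  rw [this]
  refine (norm_sum_le _ _).trans (Finset.sum_le_sum fun k _ => ?_)
  by_cases h : t ∈ Ico (τ k.castSucc) (τ k.succ)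
  · rw [indicator_of_mem h]
  · rw [indicator_of_notMem h]; simp [op]

/-- The solution of the original system is unique on `[0,T]`. -/
theorem eqOn_trajectory_const {N q : ℕ} (A : Matrix (Fin N) (Fin N) ℝ)
    (B : Matrix (Fin N) (Fin q) ℝ) (x₀ : EuclideanSpace ℝ (Fin N)) {T : ℝ} (hT : 0 ≤ T)
    (u : Control T q) {x : ℝ → EuclideanSpace ℝ (Fin N)}
    (hx : IsTrajectory (fun _ => A) B x₀ T u x) :
    EqOn (trajectory (fun _ => A) B x₀ T u) x (Icc 0 T) :=
  (isTrajectory_const A B x₀ hT u).eqOn (fun _ => le_rfl) hx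

/-- The solution of the randomized system is unique on `[0,T]`. -/
theorem eqOn_trajectory_randomMatrix {N q M K : ℕ} (Asub : Fin M → Matrix (Fin N) (Fin N) ℝ)
    (p : Finset (Fin M) → ℝ) {τ : Fin (K + 1) → ℝ} {T : ℝ} (hτ : IsGrid T τ) (ω : Sample M K)
    (B : Matrix (Fin N) (Fin q) ℝ) (x₀ : EuclideanSpace ℝ (Fin N)) (u : Control T q)
    {x : ℝ → EuclideanSpace ℝ (Fin N)}
    (hx : IsTrajectory (randomMatrix Asub p τ ω) B x₀ T u x) :
    EqOn (trajectory (randomMatrix Asub p τ ω) B x₀ T u) x (Icc 0 T) := by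
  obtain ⟨C, hC⟩ := exists_norm_randomMatrix_le Asub p τ ω
  exact (isTrajectory_randomMatrix Asub p hτ ω B x₀ u).eqOn hC hx

end RandomBatch

end

/-! Both cost functionals are quadratic: `cost_add_smul` expands them exactly into a value, a
derivative and a second-order term. Let `w = u* - u_h*`. Since the derivative of `J` vanishes at
`u*`, the gap `J(u_h*) - J(u*)` equals the second-order term of `J` at `w`, which is at most a
constant times `‖w‖²`. Expanding `J_h` between its minimizer and `u*` gives `2 H_h(w) = J_h'(u*) w`,
where `H_h` is its second-order term, and `α`-convexity gives `2 H_h(w) ≥ α ‖w‖²`. As `J'(u*) w =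
0`, the size of `w` is controlled by `J_h'(u*) w - J'(u*) w` (`sq_mul_abs_cost_sub_le`).

This difference must be estimated for a direction `w` that depends on `ω`, whereas error estimates
in expectation hold for a fixed control. The part containing the response to `w` is therefore moved
to the adjoint state (`integral_inner_trajectory_eq`). There the input `Q (x - x_d)` is
deterministic, and reversing time turns the adjoint equation into a forward one with transposed
matrices on the reversed grid. Young's inequality absorbs `‖w‖²`, leaving the squared errors of two
randomized systems with deterministic inputs (`costDeriv_sub_le`).

For such a system, `expectation_integral_norm_sq_le` bounds the expected squared error by a multiple
of `h Var[𝒜]`. Put `e = x_h - x` and `D = 𝒜_h - A`. Then `e' = 𝒜_h e + D x`, and dissipativity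
removes `𝒜_h e` from the energy balance. Replacing `e` in `⟨e, D x⟩` by its value at the start of a
step leaves a term of mean zero, because that value does not depend on the current selection and the
selection is unbiased (`expectation_inner_eq_zero`). The remainder is bounded through `e' = A e + D
y`, with `y = x_h`, which involves only `‖A‖` and `‖D‖` and never `‖𝒜_h‖` (`error_step`). A discrete
Gronwall argument sums the steps. -/

noncomputable section

namespace RandomBatch

/-! ### Primitives of integrable functions -/

/-- `z` is a primitive of the integrable function `g` on `[a,b]`. -/
structure IsPrimitive {N : ℕ} (z g : ℝ → EuclideanSpace ℝ (Fin N)) (a b : ℝ) : Prop where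
  integrable : IntervalIntegrable g volume a b
  eq_integral : ∀ t ∈ Icc a b, z t = z a + ∫ s in a..t, g s

/-- Integration by parts for absolutely continuous functions. Controls are merely square integrable,
so trajectories need not be differentiable everywhere; Lebesgue differentiation identifies the
derivatives almost everywhere. -/
theorem integral_mul_add_mul_eq_sub {x y f g : ℝ → ℝ} {a b : ℝ} (hab : a ≤ b)
    (hf : IntervalIntegrable f volume a b) (hg : IntervalIntegrable g volume a b)
    (hx : ∀ t ∈ Icc a b, x t = x a + ∫ s in a..t, f s)
    (hy : ∀ t ∈ Icc a b, y t = y a + ∫ s in a..t, g s) :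
    ∫ t in a..b, (f t * y t + x t * g t) = x b * y b - x a * y a := by
  have key : ∀ {w k : ℝ → ℝ}, IntervalIntegrable k volume a b →
      AbsolutelyContinuousOnInterval (fun t => w a + ∫ s in a..t, k s) a b := by
    intro w k hk
    exact ((LipschitzWith.const (w a)).lipschitzOnWith.absolutelyContinuousOnInterval).fun_add
      (hk.absolutelyContinuousOnInterval_intervalIntegral left_mem_uIcc)
  have h := (key (w := x) hf).integral_deriv_mul_eq_sub (key (w := y) hg)
  simp only [← hx b ⟨hab, le_rfl⟩, ← hy b ⟨hab, le_rfl⟩, intervalIntegral.integral_same,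
    add_zero] at h
  rw [← h]
  refine intervalIntegral.integral_congr_ae ?_
  filter_upwards [hf.ae_hasDerivAt_integral, hg.ae_hasDerivAt_integral] with t h1 h2 ht
  have ht' := uIoc_subset_uIcc ht
  rw [((h1 ht' a left_mem_uIcc).const_add _).deriv, ((h2 ht' a left_mem_uIcc).const_add _).deriv]
  rw [uIcc_of_le hab] at ht'
  rw [← hx t ht', ← hy t ht']

theorem integral_mono_ae_Ioc {f g : ℝ → ℝ} {a b : ℝ} (hab : a ≤ b)
    (hf : IntervalIntegrable f volume a b) (hg : IntervalIntegrable g volume a b)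
    (h : ∀ᵐ s : ℝ, s ∈ Ioc a b → f s ≤ g s) : ∫ s in a..b, f s ≤ ∫ s in a..b, g s := by
  rw [intervalIntegral.integral_of_le hab, intervalIntegral.integral_of_le hab]
  exact setIntegral_mono_ae_restrict hf.1 hg.1 ((ae_restrict_iff' measurableSet_Ioc).2 h)

theorem intervalIntegrable_inner_continuousOn {N : ℕ} {f w : ℝ → EuclideanSpace ℝ (Fin N)}
    {a b : ℝ} (hab : a ≤ b) (hf : IntervalIntegrable f volume a b) (hw : ContinuousOn w (Icc a b)) :
    IntervalIntegrable (fun t => inner ℝ (f t) (w t)) volume a b := by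
  rw [intervalIntegrable_iff_integrableOn_Ioc_of_le hab] at hf ⊢
  obtain ⟨C, hC⟩ := isCompact_Icc.exists_bound_of_continuousOn hw
  refine (hf.norm.mul_const C).mono' (hf.aestronglyMeasurable.inner
    ((hw.mono Ioc_subset_Icc_self).aestronglyMeasurable measurableSet_Ioc)) ?_
  refine (ae_restrict_iff' measurableSet_Ioc).2 (Filter.Eventually.of_forall fun t ht => ?_)
  exact (norm_inner_le_norm _ _).trans
    (mul_le_mul_of_nonneg_left (hC t (Ioc_subset_Icc_self ht)) (norm_nonneg _))

theorem intervalIntegrable_continuousOn_inner {N : ℕ} {f w : ℝ → EuclideanSpace ℝ (Fin N)}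
    {a b : ℝ} (hab : a ≤ b) (hf : IntervalIntegrable f volume a b) (hw : ContinuousOn w (Icc a b)) :
    IntervalIntegrable (fun t => inner ℝ (w t) (f t)) volume a b := by
  simpa only [real_inner_comm] using intervalIntegrable_inner_continuousOn hab hf hw

namespace IsPrimitive

variable {N : ℕ} {z w f g : ℝ → EuclideanSpace ℝ (Fin N)} {a b c d : ℝ}

theorem continuousOn (h : IsPrimitive z g a b) : ContinuousOn z (Icc a b) := by
  rcases lt_or_ge b a with hab | hab
  · simp [Icc_eq_empty (not_le.2 hab)]
  have := intervalIntegral.continuousOn_primitive_interval' h.integrable left_mem_uIcc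
  rw [uIcc_of_le hab] at this
  exact (continuousOn_const.add this).congr h.eq_integral

theorem mono (h : IsPrimitive z g a b) (hac : a ≤ c) (hcd : c ≤ d) (hdb : d ≤ b) :
    IsPrimitive z g c d where
  integrable := h.integrable.mono_set (by
    rw [uIcc_of_le hcd, uIcc_of_le (hac.trans (hcd.trans hdb))]; exact Icc_subset_Icc hac hdb)
  eq_integral := by
    intro t ht
    have hsub : ∀ {r s : ℝ}, a ≤ r → r ≤ s → s ≤ b → IntervalIntegrable g volume r s := by
      intro r s h1 h2 h3
      refine h.integrable.mono_set ?_
      rw [uIcc_of_le h2, uIcc_of_le (h1.trans (h2.trans h3))]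
      exact Icc_subset_Icc h1 h3
    have htb := ht.2.trans hdb
    rw [h.eq_integral t ⟨hac.trans ht.1, htb⟩, h.eq_integral c ⟨hac, ht.1.trans htb⟩, add_assoc,
      intervalIntegral.integral_add_adjacent_intervals (hsub le_rfl hac (ht.1.trans htb))
        (hsub hac ht.1 htb)]

theorem congr (h : IsPrimitive z f a b) (hab : a ≤ b)
    (hfg : ∀ᵐ s : ℝ, s ∈ Ioc a b → f s = g s) :
    IsPrimitive z g a b := by
  refine ⟨h.integrable.congr_ae ?_, fun t ht => ?_⟩
  · rw [Filter.EventuallyEq, ae_restrict_iff' measurableSet_uIoc, uIoc_of_le hab]; exact hfg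
  · rw [h.eq_integral t ht]
    congr 1
    refine intervalIntegral.integral_congr_ae ?_
    filter_upwards [hfg] with s hs hst
    rw [uIoc_of_le ht.1] at hst
    exact hs ⟨hst.1, hst.2.trans ht.2⟩

theorem sub (hz : IsPrimitive z f a b) (hw : IsPrimitive w g a b) :
    IsPrimitive (fun t => z t - w t) (fun t => f t - g t) a b where
  integrable := hz.integrable.sub hw.integrable
  eq_integral := by
    intro t ht
    rw [intervalIntegral.integral_sub (hz.mono le_rfl ht.1 ht.2).integrable
      (hw.mono le_rfl ht.1 ht.2).integrable, hz.eq_integral t ht, hw.eq_integral t ht]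
    abel

/-- The scalar product rule summed over coordinates. With `w = z` it is the energy identity; with a
state and an adjoint state it is the duality relation. -/
theorem integral_inner_add_inner (hz : IsPrimitive z f a b) (hw : IsPrimitive w g a b)
    (hab : a ≤ b) :
    ∫ t in a..b, (inner ℝ (f t) (w t) + inner ℝ (z t) (g t))
      = inner ℝ (z b) (w b) - inner ℝ (z a) (w a) := by
  have coord : ∀ {y k : ℝ → EuclideanSpace ℝ (Fin N)}, IsPrimitive y k a b → ∀ i,
      IntervalIntegrable (fun t => k t i) volume a b ∧
      ∀ t ∈ Icc a b, y t i = y a i + ∫ s in a..t, k s i := by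
    intro y k h i
    refine ⟨⟨(EuclideanSpace.proj (𝕜 := ℝ) i).integrable_comp h.integrable.1,
      (EuclideanSpace.proj (𝕜 := ℝ) i).integrable_comp h.integrable.2⟩, fun t ht => ?_⟩
    have := ContinuousLinearMap.intervalIntegral_comp_comm
      (EuclideanSpace.proj i : EuclideanSpace ℝ (Fin N) →L[ℝ] ℝ) (h.mono le_rfl ht.1 ht.2).integrable
    rw [h.eq_integral t ht]
    simp only [PiLp.proj_apply] at this
    rw [this]
    rfl
  have hi : ∀ i, IntervalIntegrable (fun t => f t i * w t i + z t i * g t i) volume a b := by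
    intro i
    have e : ContinuousOn (fun t => w t i) (uIcc a b) := by
      rw [uIcc_of_le hab]
      exact (EuclideanSpace.proj (𝕜 := ℝ) i).continuous.comp_continuousOn hw.continuousOn
    have e' : ContinuousOn (fun t => z t i) (uIcc a b) := by
      rw [uIcc_of_le hab]
      exact (EuclideanSpace.proj (𝕜 := ℝ) i).continuous.comp_continuousOn hz.continuousOn
    exact ((coord hz i).1.mul_continuousOn e).add ((coord hw i).1.continuousOn_mul e')
  have e1 : ∀ t, inner ℝ (f t) (w t) + inner ℝ (z t) (g t)
      = ∑ i, (f t i * w t i + z t i * g t i) := by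
    intro t
    simp only [PiLp.inner_apply, Finset.sum_add_distrib]
    simp [mul_comm]
  simp_rw [e1]
  rw [intervalIntegral.integral_finsetSum fun i _ => hi i]
  simp_rw [fun i => integral_mul_add_mul_eq_sub hab (coord hz i).1 (coord hw i).1
    (coord hz i).2 (coord hw i).2]
  simp [PiLp.inner_apply, mul_comm]

theorem norm_sq_sub_norm_sq (hz : IsPrimitive z g a b) (hab : a ≤ b) :
    ‖z b‖ ^ 2 - ‖z a‖ ^ 2 = 2 * ∫ t in a..b, inner ℝ (z t) (g t) := by
  have h := hz.integral_inner_add_inner hz hab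
  rw [real_inner_self_eq_norm_sq, real_inner_self_eq_norm_sq] at h
  rw [← h, ← intervalIntegral.integral_const_mul]
  congr 1; ext t; rw [real_inner_comm (g t)]; ring

/-- An energy estimate. -/
theorem norm_le (hz : IsPrimitive z g a b) {φ : ℝ → ℝ}
    (hφ : IntervalIntegrable φ volume a b) (hφ0 : ∀ s, 0 ≤ φ s)
    (h : ∀ᵐ s : ℝ, s ∈ Ioc a b → inner ℝ (z s) (g s) ≤ ‖z s‖ * φ s) {t : ℝ} (ht : t ∈ Icc a b) :
    ‖z t‖ ≤ ‖z a‖ + 2 * ∫ s in a..b, φ s := by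
  have hab := ht.1.trans ht.2
  -- The energy identity is used on `[a, m]` only, where `m` maximizes `‖z‖`; it yields `‖z m‖² ≤ ‖z
  -- a‖² + 2 ‖z m‖ ∫ φ`.
  obtain ⟨m, hm, hmax⟩ := isCompact_Icc.exists_isMaxOn (nonempty_Icc.2 hab) hz.continuousOn.norm
  have hmax' : ∀ s ∈ Icc a b, ‖z s‖ ≤ ‖z m‖ := fun s hs => hmax hs
  have hI : 0 ≤ ∫ s in a..b, φ s := intervalIntegral.integral_nonneg hab fun s _ => hφ0 s
  have hsub : IntervalIntegrable φ volume a m :=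
    hφ.mono_set (by rw [uIcc_of_le hm.1, uIcc_of_le hab]; exact Icc_subset_Icc_right hm.2)
  have hsub' : IntervalIntegrable φ volume m b :=
    hφ.mono_set (by rw [uIcc_of_le hm.2, uIcc_of_le hab]; exact Icc_subset_Icc_left hm.1)
  have hzm := hz.mono le_rfl hm.1 hm.2
  have e := hzm.norm_sq_sub_norm_sq hm.1
  have h1 : ∫ t in a..m, inner ℝ (z t) (g t) ≤ ∫ s in a..m, ‖z m‖ * φ s := by
    refine integral_mono_ae_Ioc hm.1 (intervalIntegrable_continuousOn_inner hm.1 hzm.integrable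
      hzm.continuousOn) (hsub.const_mul _) ?_
    filter_upwards [h] with s hs hsm
    have hs' : s ∈ Ioc a b := ⟨hsm.1, hsm.2.trans hm.2⟩
    exact (hs hs').trans
      (mul_le_mul_of_nonneg_right (hmax' s (Ioc_subset_Icc_self hs')) (hφ0 s))
  have h2 : ∫ s in a..m, φ s ≤ ∫ s in a..b, φ s := by
    rw [← intervalIntegral.integral_add_adjacent_intervals hsub hsub']
    linarith [intervalIntegral.integral_nonneg (μ := volume) hm.2 fun s _ => hφ0 s]
  rw [intervalIntegral.integral_const_mul] at h1
  have h3 := hmax' a ⟨le_rfl, hab⟩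
  have hmm : ‖z m‖ ≤ ‖z a‖ + 2 * ∫ s in a..b, φ s := by
    -- Division by `‖z m‖` is possible unless it vanishes, and `‖z a‖ ≤ ‖z m‖` reduces `‖z a‖²` to
    -- `‖z a‖ ‖z m‖`.
    rcases (norm_nonneg (z m)).eq_or_lt with h0 | h0
    · rw [← h0]; positivity
    · refine le_of_mul_le_mul_left ?_ h0
      have := mul_le_mul_of_nonneg_left h2 h0.le
      nlinarith [mul_le_mul_of_nonneg_right h3 (norm_nonneg (z a))]
  exact (hmax' t ht).trans hmm

end IsPrimitive

/-! ### Operators given by matrices -/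

section Operators

variable {m n : ℕ}

theorem op_sub (M M' : Matrix (Fin m) (Fin n) ℝ) : op (M - M') = op M - op M' := by
  simp [op]

theorem op_smul (c : ℝ) (M : Matrix (Fin m) (Fin n) ℝ) : op (c • M) = c • op M := by
  simp [op]

theorem op_sum {ι : Type*} (s : Finset ι) (M : ι → Matrix (Fin m) (Fin n) ℝ) :
    op (∑ i ∈ s, M i) = ∑ i ∈ s, op (M i) := by
  simp [op]

theorem op_zero : op (0 : Matrix (Fin m) (Fin n) ℝ) = 0 := by
  simp [op]

theorem op_one_apply (x : EuclideanSpace ℝ (Fin n)) : op (1 : Matrix (Fin n) (Fin n) ℝ) x = x := by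
  simp [op]

theorem op_transpose (M : Matrix (Fin m) (Fin n) ℝ) :
    op M.transpose = ContinuousLinearMap.adjoint (op M) := by
  have h := Matrix.toEuclideanLin_conjTranspose_eq_adjoint M
  rw [Matrix.conjTranspose_eq_transpose_of_trivial] at h
  unfold op
  rw [h, LinearMap.adjoint_eq_toCLM_adjoint]
  rfl

theorem norm_op_transpose (M : Matrix (Fin m) (Fin n) ℝ) : ‖op M.transpose‖ = ‖op M‖ := by
  rw [op_transpose]; exact LinearIsometryEquiv.norm_map _ _

theorem inner_op_left (M : Matrix (Fin m) (Fin n) ℝ) (x : EuclideanSpace ℝ (Fin n))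
    (y : EuclideanSpace ℝ (Fin m)) : inner ℝ (op M x) y = inner ℝ x (op M.transpose y) := by
  rw [op_transpose, ContinuousLinearMap.adjoint_inner_right]

theorem inner_op_comm {M : Matrix (Fin n) (Fin n) ℝ} (hM : M.PosSemidef)
    (x y : EuclideanSpace ℝ (Fin n)) : inner ℝ (op M x) y = inner ℝ x (op M y) := by
  rw [inner_op_left, ← Matrix.conjTranspose_eq_transpose_of_trivial, hM.isHermitian]

theorem inner_op_nonneg {M : Matrix (Fin n) (Fin n) ℝ} (hM : M.PosSemidef)
    (x : EuclideanSpace ℝ (Fin n)) : 0 ≤ inner ℝ x (op M x) := by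
  have := (Matrix.isPositive_toEuclideanLin_iff.2 hM).inner_nonneg_right x
  exact this

theorem inner_op_le (M : Matrix (Fin m) (Fin n) ℝ) (x : EuclideanSpace ℝ (Fin m))
    (y : EuclideanSpace ℝ (Fin n)) : inner ℝ x (op M y) ≤ ‖op M‖ * (‖x‖ * ‖y‖) := by
  refine (real_inner_le_norm _ _).trans ?_
  nlinarith [mul_le_mul_of_nonneg_left ((op M).le_opNorm y) (norm_nonneg x)]

/-- The quadratic form attains a positive minimum on the compact unit sphere, and homogeneity does
the rest. Dimension zero is separate because its sphere is empty. -/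
theorem exists_pos_le_inner_op {M : Matrix (Fin n) (Fin n) ℝ} (hM : M.PosDef) :
    ∃ r : ℝ, 0 < r ∧ ∀ x, r * ‖x‖ ^ 2 ≤ inner ℝ x (op M x) := by
  have hpos : ∀ x : EuclideanSpace ℝ (Fin n), x ≠ 0 → 0 < inner ℝ x (op M x) := by
    intro x hx
    have := hM.dotProduct_mulVec_pos (x := x.ofLp) (by simpa using hx)
    simpa [op, EuclideanSpace.inner_eq_star_dotProduct, dotProduct_comm] using this
  rcases n.eq_zero_or_pos with rfl | hn
  · exact ⟨1, one_pos, fun x => by simp [Subsingleton.elim x 0]⟩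
  have : Nonempty (Fin n) := ⟨⟨0, hn⟩⟩
  have hc : Continuous fun x : EuclideanSpace ℝ (Fin n) => (inner ℝ x (op M x) : ℝ) :=
    continuous_id.inner (op M).continuous
  obtain ⟨y, hy, hmin⟩ := (isCompact_sphere (0 : EuclideanSpace ℝ (Fin n)) 1).exists_isMinOn
    (NormedSpace.sphere_nonempty.2 zero_le_one) hc.continuousOn
  have hy0 : y ≠ 0 := by
    rintro rfl; simp at hy
  refine ⟨_, hpos y hy0, fun x => ?_⟩
  rcases eq_or_ne x 0 with rfl | hx
  · simp
  have hnx : 0 < ‖x‖ := norm_pos_iff.2 hx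
  have h : inner ℝ y (op M y) ≤ inner ℝ (‖x‖⁻¹ • x) (op M (‖x‖⁻¹ • x)) :=
    hmin (by simp [norm_smul, hnx.ne'])
  rw [map_smul, real_inner_smul_left, real_inner_smul_right] at h
  calc _ ≤ (‖x‖⁻¹ * (‖x‖⁻¹ * inner ℝ x (op M x))) * ‖x‖ ^ 2 := by gcongr
    _ = _ := by field_simp

end Operators

/-! ### Expectations -/

section Expectation

variable {M K : ℕ} {p : Finset (Fin M) → ℝ}

theorem expectation_mono (hp : ∀ S, 0 ≤ p S) {X Y : Sample M K → ℝ} (h : ∀ ω, X ω ≤ Y ω) :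
    expectation p X ≤ expectation p Y :=
  Finset.sum_le_sum fun ω _ =>
    mul_le_mul_of_nonneg_right (h ω) (Finset.prod_nonneg fun k _ => hp (ω k))

theorem expectation_add (X Y : Sample M K → ℝ) :
    expectation p (fun ω => X ω + Y ω) = expectation p X + expectation p Y := by
  simp [expectation, add_mul, Finset.sum_add_distrib]

theorem expectation_const_mul (c : ℝ) (X : Sample M K → ℝ) :
    expectation p (fun ω => c * X ω) = c * expectation p X := by
  simp [expectation, mul_assoc, Finset.mul_sum]

theorem expectation_const (h1 : ∑ S, p S = 1) (c : ℝ) :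
    expectation p (fun _ : Sample M K => c) = c := by
  unfold expectation
  rw [← Finset.mul_sum, ← Fintype.piFinset_univ, Finset.sum_prod_piFinset]
  simp [h1]

/-- Resampling the subset selected in one time interval does not change expectations. -/
theorem expectation_resample (h1 : ∑ S, p S = 1) (k : Fin K) (X : Sample M K → ℝ) :
    expectation p X = expectation p (fun ω => ∑ S, p S * X (Function.update ω k S)) := by
  obtain _ | n := K
  · exact k.elim0
  unfold expectation
  -- A sample is split into its `k`-th coordinate and the remaining ones. After resampling, the old
  -- `k`-th coordinate occurs only in its weight and sums to `1`.
  rw [← (Fin.insertNthEquiv (fun _ => Finset (Fin M)) k).sum_comp,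
    ← (Fin.insertNthEquiv (fun _ => Finset (Fin M)) k).sum_comp, Fintype.sum_prod_type,
    Fintype.sum_prod_type, Finset.sum_comm, Finset.sum_comm (s := Finset.univ (α := Finset (Fin M)))]
  refine Finset.sum_congr rfl fun r _ => ?_
  have e : ∀ S' S, Function.update (Fin.insertNthEquiv (fun _ => Finset (Fin M)) k (S', r)) k S
      = Fin.insertNthEquiv (fun _ => Finset (Fin M)) k (S, r) :=
    fun S' S => Fin.update_insertNth (α := fun _ => Finset (Fin M)) k S' S r
  simp only [e]
  simp only [Fin.insertNthEquiv_apply, Fin.prod_univ_succAbove _ k, Fin.insertNth_apply_same,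
    Fin.insertNth_apply_succAbove]
  rw [← Finset.mul_sum, ← Finset.sum_mul, h1, one_mul, Finset.sum_mul]
  exact Finset.sum_congr rfl fun S _ => by ring

/-- Unbiasedness of the splitting: exchanging the sums, the total weight of the subsets containing
`m` is `π_m`, which cancels the factor `1 / π_m`. -/
theorem sum_smul_subsetMatrix {N : ℕ} (Asub : Fin M → Matrix (Fin N) (Fin N) ℝ)
    (hπ : ∀ m, 0 < inclusionProb p m) : ∑ S, p S • subsetMatrix Asub p S = ∑ m, Asub m := by
  have e : ∀ S, p S • subsetMatrix Asub p S
      = ∑ m, if m ∈ S then (p S * (inclusionProb p m)⁻¹) • Asub m else 0 := by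
    intro S
    simp [subsetMatrix, Finset.smul_sum, smul_smul, Finset.sum_ite_mem]
  simp_rw [e]
  rw [Finset.sum_comm]
  refine Finset.sum_congr rfl fun m _ => ?_
  rw [← Finset.sum_filter, ← Finset.sum_smul, ← Finset.sum_mul]
  have : ∑ S : Finset (Fin M) with m ∈ S, p S = inclusionProb p m := rfl
  rw [this, mul_inv_cancel₀ (hπ m).ne', one_smul]

end Expectation

/-! ### Dissipative systems -/

theorem inner_subsetMatrix_nonpos {N M : ℕ} {Asub : Fin M → Matrix (Fin N) (Fin N) ℝ}
    {p : Finset (Fin M) → ℝ} (hdis : ∀ m x, inner ℝ x (op (Asub m) x) ≤ 0)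
    (hπ : ∀ m, 0 < inclusionProb p m) (S : Finset (Fin M)) (x : EuclideanSpace ℝ (Fin N)) :
    inner ℝ x (op (subsetMatrix Asub p S) x) ≤ 0 := by
  simp only [subsetMatrix, op_sum, op_smul, sum_apply, inner_sum,
    smul_apply, real_inner_smul_right]
  exact Finset.sum_nonpos fun m _ =>
    mul_nonpos_of_nonneg_of_nonpos (inv_nonneg.2 (hπ m).le) (hdis m x)

theorem inner_randomMatrix_nonpos {N M K : ℕ} {Asub : Fin M → Matrix (Fin N) (Fin N) ℝ}
    {p : Finset (Fin M) → ℝ} (hdis : ∀ m x, inner ℝ x (op (Asub m) x) ≤ 0)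
    (hπ : ∀ m, 0 < inclusionProb p m) (τ : Fin (K + 1) → ℝ) (ω : Sample M K) (t : ℝ)
    (x : EuclideanSpace ℝ (Fin N)) : inner ℝ x (op (randomMatrix Asub p τ ω t) x) ≤ 0 := by
  simp only [randomMatrix, op_sum, sum_apply, inner_sum]
  refine Finset.sum_nonpos fun k _ => ?_
  by_cases h : t ∈ Ico (τ k.castSucc) (τ k.succ)
  · rw [indicator_of_mem h]; exact inner_subsetMatrix_nonpos hdis hπ _ _
  · rw [indicator_of_notMem h, op_zero]; simp

namespace IsTrajectory

variable {N q : ℕ} {F G : ℝ → Matrix (Fin N) (Fin N) ℝ} {B : Matrix (Fin N) (Fin q) ℝ}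
  {x₀ : EuclideanSpace ℝ (Fin N)} {T : ℝ} {u : ℝ → EuclideanSpace ℝ (Fin q)}
  {x y : ℝ → EuclideanSpace ℝ (Fin N)}

theorem apply_zero (hx : IsTrajectory F B x₀ T u x) (hT : 0 ≤ T) : x 0 = x₀ := by
  simpa using hx.eq_integral 0 ⟨le_rfl, hT⟩

theorem isPrimitive (hx : IsTrajectory F B x₀ T u x) (hT : 0 ≤ T) :
    IsPrimitive x (fun s => op (F s) (x s) + op B (u s)) 0 T :=
  ⟨hx.integrable, fun t ht => by rw [hx.apply_zero hT]; exact hx.eq_integral t ht⟩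

/-- The dissipative term only decreases the energy, so no norm of `F` enters. Hence the bound is
uniform over all samples and all splittings of `A`. -/
theorem norm_le (hx : IsTrajectory F B x₀ T u x) (hF : ∀ t v, inner ℝ v (op (F t) v) ≤ 0)
    (hu : IntervalIntegrable (fun s => ‖op B (u s)‖) volume 0 T) {t : ℝ} (ht : t ∈ Icc 0 T) :
    ‖x t‖ ≤ ‖x₀‖ + 2 * ∫ s in (0 : ℝ)..T, ‖op B (u s)‖ := by
  have hT := ht.1.trans ht.2
  have := (hx.isPrimitive hT).norm_le hu (fun _ => norm_nonneg _)
    (Filter.Eventually.of_forall fun s _ => by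
      rw [inner_add_right]
      linarith [hF s (x s), real_inner_le_norm (x s) (op B (u s))]) ht
  rwa [hx.apply_zero hT] at this

theorem mono {S : ℝ} (hx : IsTrajectory F B x₀ T u x) (hS : 0 ≤ S) (hST : S ≤ T) :
    IsTrajectory F B x₀ S u x where
  continuousOn := hx.continuousOn.mono (Icc_subset_Icc_right hST)
  integrable := ((hx.isPrimitive (hS.trans hST)).mono le_rfl hS hST).integrable
  eq_integral := fun t ht => hx.eq_integral t ⟨ht.1, ht.2.trans hST⟩

theorem congr (hx : IsTrajectory F B x₀ T u x) (hT : 0 ≤ T)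
    (h : ∀ᵐ s : ℝ, s ∈ Ioc 0 T → F s = G s) : IsTrajectory G B x₀ T u x := by
  have := (hx.isPrimitive hT).congr (g := fun s => op (G s) (x s) + op B (u s)) hT (by
    filter_upwards [h] with s hs hsT
    rw [hs hsT])
  exact ⟨hx.continuousOn, this.integrable, fun t ht => by
    rw [this.eq_integral t ht, hx.apply_zero hT]⟩

end IsTrajectory

theorem ae_randomMatrix_eq {N M K : ℕ} (Asub : Fin M → Matrix (Fin N) (Fin N) ℝ)
    (p : Finset (Fin M) → ℝ) {τ : Fin (K + 1) → ℝ} (hτ : StrictMono τ) (ω : Sample M K)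
    (k : Fin K) : ∀ᵐ s : ℝ, s ∈ Ioc (τ k.castSucc) (τ k.succ) →
      randomMatrix Asub p τ ω s = subsetMatrix Asub p (ω k) := by
  have hne : ∀ᵐ s : ℝ, s ≠ τ k.succ := by simp [ae_iff]
  filter_upwards [hne] with s hs hsI
  exact randomMatrix_eq Asub p hτ ω k ⟨hsI.1.le, lt_of_le_of_ne hsI.2 hs⟩

theorem IsGrid.nonneg {T : ℝ} {K : ℕ} {τ : Fin (K + 1) → ℝ} (hτ : IsGrid T τ) (k : Fin (K + 1)) :
    0 ≤ τ k :=
  hτ.zero ▸ hτ.strictMono.monotone (Fin.zero_le k)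

theorem IsGrid.le {T : ℝ} {K : ℕ} {τ : Fin (K + 1) → ℝ} (hτ : IsGrid T τ) (k : Fin (K + 1)) :
    τ k ≤ T :=
  hτ.last ▸ hτ.strictMono.monotone (Fin.le_last k)

theorem IsGrid.sub_le_gridSpacing {K : ℕ} (τ : Fin (K + 1) → ℝ) (k : Fin K) :
    τ k.succ - τ k.castSucc ≤ gridSpacing τ :=
  le_ciSup (f := fun k : Fin K => τ k.succ - τ k.castSucc) (Set.finite_range _).bddAbove k

theorem IsGrid.gridSpacing_nonneg {T : ℝ} {K : ℕ} {τ : Fin (K + 1) → ℝ} (hτ : IsGrid T τ) :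
    0 ≤ gridSpacing τ :=
  Real.iSup_nonneg fun k => sub_nonneg.2 (hτ.strictMono.monotone (Fin.castSucc_le_succ k))

/-- The randomized trajectory at the beginning of a time interval does not depend on the subset
selected in this interval. -/
theorem trajectory_update_eq {N q M K : ℕ} (Asub : Fin M → Matrix (Fin N) (Fin N) ℝ)
    (p : Finset (Fin M) → ℝ) {τ : Fin (K + 1) → ℝ} {T : ℝ} (hτ : IsGrid T τ) (ω : Sample M K)
    (k : Fin K) (S : Finset (Fin M)) (B : Matrix (Fin N) (Fin q) ℝ)
    (x₀ : EuclideanSpace ℝ (Fin N)) (u : Control T q) :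
    trajectory (randomMatrix Asub p τ (Function.update ω k S)) B x₀ T u (τ k.castSucc)
      = trajectory (randomMatrix Asub p τ ω) B x₀ T u (τ k.castSucc) := by
  obtain ⟨C, hC⟩ := exists_norm_randomMatrix_le Asub p τ ω
  have h0 := hτ.nonneg k.castSucc
  have h1 := (isTrajectory_randomMatrix Asub p hτ ω B x₀ u).mono h0 (hτ.le k.castSucc)
  have h2 := (isTrajectory_randomMatrix Asub p hτ (Function.update ω k S) B x₀ u).mono h0
    (hτ.le k.castSucc)
  refine (h2.congr h0 ?_).eqOn hC h1 ⟨h0, le_rfl⟩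
  -- Up to time `τ k.castSucc` the two coefficient functions can differ only at this single instant.
  have hne : ∀ᵐ s : ℝ, s ≠ τ k.castSucc := by simp [ae_iff]
  filter_upwards [hne] with s hs hsI
  unfold randomMatrix
  refine Finset.sum_congr rfl fun j _ => ?_
  rcases eq_or_ne j k with rfl | hj
  · have : s ∉ Ico (τ j.castSucc) (τ j.succ) := fun h => hs (le_antisymm hsI.2 h.1)
    rw [indicator_of_notMem this, indicator_of_notMem this]
  · rw [Function.update_of_ne hj]

/-! ### The error of the randomized system -/

/-- Estimates for the difference `e = y - x` of solutions of `y' = A' y + f` and `x' = A x + f`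
on `[c,d]` that do not involve the norm of the dissipative matrix `A'`. -/
theorem error_step {N : ℕ} {A A' : Matrix (Fin N) (Fin N) ℝ}
    (hA' : ∀ v, inner ℝ v (op A' v) ≤ 0) {x y : ℝ → EuclideanSpace ℝ (Fin N)} {c d T h X : ℝ}
    (hcd : c ≤ d) (hdh : d - c ≤ h) (hdT : d - c ≤ T) (hx : ContinuousOn x (Icc c d))
    (hxX : ∀ t ∈ Icc c d, ‖x t‖ ≤ X) (hyX : ∀ t ∈ Icc c d, ‖y t‖ ≤ X)
    (he : IsPrimitive (fun t => y t - x t) (fun t => op A' (y t) - op A (x t)) c d) :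
    (∀ t ∈ Icc c d, ‖y t - x t‖ ≤ ‖y c - x c‖ + 2 * ((d - c) * (‖op (A' - A)‖ * X))) ∧
    ‖y d - x d‖ ^ 2 ≤ ‖y c - x c‖ ^ 2 + 2 * inner ℝ (y c - x c) (op (A' - A) (∫ s in c..d, x s))
      + (d - c) * (‖op A‖ * ‖y c - x c‖ ^ 2
        + h * ‖op (A' - A)‖ ^ 2 * (X ^ 2 * (5 * ‖op A‖ * T + 2))) := by
  set D := op (A' - A) with hD
  set e := fun t => y t - x t with he_def
  have hX : 0 ≤ X := (norm_nonneg _).trans (hxX c ⟨le_rfl, hcd⟩)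
  have hδ : 0 ≤ d - c := sub_nonneg.2 hcd
  have hDX : 0 ≤ ‖D‖ * X := by positivity
  -- Two splittings of the same right-hand side: this one puts `A'` in front of `e`, where
  -- dissipativity discards it in inner products with `e`. The next puts `A` there, for norm bounds
  -- that must not involve `‖A'‖`.
  have eg : ∀ t, op A' (y t) - op A (x t) = op A' (e t) + D (x t) := by
    intro t; simp only [hD, op_sub, he_def, map_sub, sub_apply]; abel
  have eg' : ∀ t, op A' (y t) - op A (x t) = op A (e t) + D (y t) := by
    intro t; simp only [hD, op_sub, he_def, map_sub, sub_apply]; abel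
  have hDx : ∀ t ∈ Icc c d, ‖D (x t)‖ ≤ ‖D‖ * X := fun t ht =>
    (D.le_opNorm _).trans (mul_le_mul_of_nonneg_left (hxX t ht) (norm_nonneg _))
  have hDy : ∀ t ∈ Icc c d, ‖D (y t)‖ ≤ ‖D‖ * X := fun t ht =>
    (D.le_opNorm _).trans (mul_le_mul_of_nonneg_left (hyX t ht) (norm_nonneg _))
  have hb : ∀ t ∈ Icc c d, ‖e t‖ ≤ ‖e c‖ + 2 * ((d - c) * (‖D‖ * X)) := by
    intro t ht
    have := he.norm_le (φ := fun _ => ‖D‖ * X) intervalIntegrable_const (fun _ => hDX)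
      (Filter.Eventually.of_forall fun s hs => by
        rw [eg, inner_add_right]
        have h1 := hA' (e s)
        have h2 := real_inner_le_norm (e s) (D (x s))
        have h3 := mul_le_mul_of_nonneg_left (hDx s (Ioc_subset_Icc_self hs)) (norm_nonneg (e s))
        linarith) ht
    rwa [intervalIntegral.integral_const, smul_eq_mul] at this
  refine ⟨hb, ?_⟩
  -- `η` bounds the change of `e` within the step; it is the price for replacing `e t` by `e c` in
  -- the inner product with `D (x t)`.
  set η := (‖op A‖ * (‖e c‖ + 2 * ((d - c) * (‖D‖ * X))) + ‖D‖ * X) * (d - c) with hη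
  have hη0 : 0 ≤ η := by positivity
  have hinc : ∀ t ∈ Icc c d, ‖e t - e c‖ ≤ η := by
    intro t ht
    rw [he.eq_integral t ht, add_sub_cancel_left]
    refine (intervalIntegral.norm_integral_le_of_norm_le_const (C := ‖op A‖ * (‖e c‖ +
      2 * ((d - c) * (‖D‖ * X))) + ‖D‖ * X) ?_).trans ?_
    · intro s hs
      rw [uIoc_of_le ht.1] at hs
      have hs' : s ∈ Icc c d := ⟨hs.1.le, hs.2.trans ht.2⟩
      rw [eg']
      refine (norm_add_le _ _).trans (add_le_add ?_ (hDy s hs'))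
      exact ((op A).le_opNorm _).trans (mul_le_mul_of_nonneg_left (hb s hs') (norm_nonneg _))
    · rw [abs_of_nonneg (sub_nonneg.2 ht.1)]
      exact mul_le_mul_of_nonneg_left (by linarith [ht.2]) (by positivity)
  have hxi : IntervalIntegrable x volume c d := by
    rw [← uIcc_of_le hcd] at hx; exact hx.intervalIntegrable
  have hDxi : IntervalIntegrable (fun t => D (x t)) volume c d :=
    ⟨D.integrable_comp hxi.1, D.integrable_comp hxi.2⟩
  have hci : IntervalIntegrable (fun t => inner ℝ (e c) (D (x t))) volume c d :=
    intervalIntegrable_continuousOn_inner hcd hDxi continuousOn_const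
  have hE := he.norm_sq_sub_norm_sq hcd
  have hI : ∫ t in c..d, inner ℝ (e t) (op A' (y t) - op A (x t))
      ≤ ∫ t in c..d, (inner ℝ (e c) (D (x t)) + η * (‖D‖ * X)) := by
    refine integral_mono_ae_Ioc hcd
      (intervalIntegrable_continuousOn_inner hcd he.integrable he.continuousOn)
      (hci.add intervalIntegrable_const) (Filter.Eventually.of_forall fun s hs => ?_)
    have hs' := Ioc_subset_Icc_self hs
    have h1 := hA' (e s)
    have h2 : inner ℝ (e s - e c) (D (x s)) ≤ η * (‖D‖ * X) :=
      (real_inner_le_norm _ _).trans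
        (mul_le_mul (hinc s hs') (hDx s hs') (norm_nonneg _) hη0)
    rw [inner_sub_left] at h2
    rw [eg, inner_add_right]
    linarith
  have hcomp : ∫ t in c..d, inner ℝ (e c) (D (x t)) = inner ℝ (e c) (D (∫ s in c..d, x s)) :=
    ((innerSL ℝ (e c)).comp D).intervalIntegral_comp_comm hxi
  rw [intervalIntegral.integral_add hci intervalIntegrable_const, hcomp,
    intervalIntegral.integral_const, smul_eq_mul] at hI
  have hfin : 2 * ((d - c) * (η * (‖D‖ * X))) ≤ (d - c) * (‖op A‖ * ‖e c‖ ^ 2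
        + h * ‖D‖ ^ 2 * (X ^ 2 * (5 * ‖op A‖ * T + 2))) := by
    rw [mul_left_comm]
    refine mul_le_mul_of_nonneg_left ?_ hδ
    have h1 : 2 * (η * (‖D‖ * X)) ≤ ‖op A‖ * ‖e c‖ ^ 2
        + (d - c) * ‖D‖ ^ 2 * (X ^ 2 * (5 * ‖op A‖ * (d - c) + 2)) := by
      -- This square splits the mixed term in `‖e c‖` and `‖D‖ X`; it adds one to the coefficient
      -- `4` coming from `η`, whence the `5`.
      have := mul_nonneg (norm_nonneg (op A)) (sq_nonneg (‖e c‖ - (d - c) * (‖D‖ * X)))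
      rw [hη]; nlinarith
    have hh : 0 ≤ h := hδ.trans hdh
    refine h1.trans ?_
    gcongr
  show ‖e d‖ ^ 2 ≤ ‖e c‖ ^ 2 + 2 * inner ℝ (e c) (D (∫ s in c..d, x s)) + _
  linarith

/-- The constant in the error estimate for the randomized system. -/
def errorConst (T a X : ℝ) : ℝ :=
  T * (2 * (Real.exp (a * T) * (T * (X ^ 2 * (5 * a * T + 2)))) + 8 * T * X ^ 2)

theorem errorConst_nonneg {T a X : ℝ} (hT : 0 ≤ T) (ha : 0 ≤ a) : 0 ≤ errorConst T a X := by
  unfold errorConst; positivity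

theorem varA_nonneg {N M : ℕ} (A : Matrix (Fin N) (Fin N) ℝ)
    (Asub : Fin M → Matrix (Fin N) (Fin N) ℝ) {p : Finset (Fin M) → ℝ} (hp : ∀ S, 0 ≤ p S) :
    0 ≤ varA A Asub p :=
  Finset.sum_nonneg fun S _ => mul_nonneg (sq_nonneg _) (hp S)

/-- Resampling the `k`-th subset turns the integrand into the constant `Var[𝒜]`. -/
theorem expectation_norm_sq_eq_varA {N M K : ℕ} (A : Matrix (Fin N) (Fin N) ℝ)
    (Asub : Fin M → Matrix (Fin N) (Fin N) ℝ) {p : Finset (Fin M) → ℝ} (h1 : ∑ S, p S = 1)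
    (k : Fin K) : expectation p (fun ω => ‖op (subsetMatrix Asub p (ω k) - A)‖ ^ 2)
      = varA A Asub p := by
  rw [expectation_resample h1 k]
  simp only [Function.update_self]
  rw [expectation_const h1]
  exact Finset.sum_congr rfl fun S _ => mul_comm _ _

/-- `Y` is independent of the `k`-th selection and `ξ` is deterministic, so averaging over that
selection alone already gives zero by unbiasedness. This cancellation is the source of the rate `h`.
-/
theorem expectation_inner_eq_zero {N M K : ℕ} {A : Matrix (Fin N) (Fin N) ℝ}
    {Asub : Fin M → Matrix (Fin N) (Fin N) ℝ} {p : Finset (Fin M) → ℝ} (hA : A = ∑ m, Asub m)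
    (h1 : ∑ S, p S = 1) (hπ : ∀ m, 0 < inclusionProb p m) (k : Fin K)
    {Y : Sample M K → EuclideanSpace ℝ (Fin N)} (hY : ∀ ω S, Y (Function.update ω k S) = Y ω)
    (ξ : EuclideanSpace ℝ (Fin N)) :
    expectation p (fun ω => inner ℝ (Y ω) (op (subsetMatrix Asub p (ω k) - A) ξ)) = 0 := by
  rw [expectation_resample h1 k]
  simp only [Function.update_self, hY]
  have h0 : ∑ S, p S • op (subsetMatrix Asub p S - A) = 0 := by
    simp_rw [op_sub, smul_sub]
    rw [Finset.sum_sub_distrib, ← Finset.sum_smul, h1, one_smul]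
    simp_rw [← op_smul]
    rw [← op_sum, sum_smul_subsetMatrix Asub hπ, ← hA, sub_self]
  have e : ∀ ω, ∑ S, p S * inner ℝ (Y ω) (op (subsetMatrix Asub p S - A) ξ) = 0 := by
    intro ω
    have := congrArg (fun L => inner ℝ (Y ω) (L ξ)) h0
    simpa [sum_apply, inner_sum, real_inner_smul_right] using this
  simp_rw [e]
  exact expectation_const h1 0

section ErrorEstimate

variable {N q M K : ℕ} {A : Matrix (Fin N) (Fin N) ℝ} {Asub : Fin M → Matrix (Fin N) (Fin N) ℝ}
  {p : Finset (Fin M) → ℝ} {τ : Fin (K + 1) → ℝ} {T X : ℝ}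

theorem inner_sum_nonpos (hA : A = ∑ m, Asub m) (hdis : ∀ m x, inner ℝ x (op (Asub m) x) ≤ 0)
    (x : EuclideanSpace ℝ (Fin N)) : inner ℝ x (op A x) ≤ 0 := by
  rw [hA, op_sum, sum_apply, inner_sum]
  exact Finset.sum_nonpos fun m _ => hdis m x

theorem Control.intervalIntegrable_norm_op (hT : 0 ≤ T) (B : Matrix (Fin N) (Fin q) ℝ)
    (u : Control T q) : IntervalIntegrable (fun s => ‖op B (u s)‖) volume 0 T := by
  have hu := Control.intervalIntegrable hT u
  exact IntervalIntegrable.norm ⟨(op B).integrable_comp hu.1, (op B).integrable_comp hu.2⟩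

/-- The expected squared error of the randomized system over the time horizon. -/
theorem expectation_integral_norm_sq_le (hA : A = ∑ m, Asub m)
    (hdis : ∀ m x, inner ℝ x (op (Asub m) x) ≤ 0) (hp : ∀ S, 0 ≤ p S) (h1 : ∑ S, p S = 1)
    (hπ : ∀ m, 0 < inclusionProb p m) (hτ : IsGrid T τ) (hT : 0 ≤ T)
    (B : Matrix (Fin N) (Fin q) ℝ) (x₀ : EuclideanSpace ℝ (Fin N)) (u : Control T q)
    (hX : ‖x₀‖ + 2 * ∫ s in (0 : ℝ)..T, ‖op B (u s)‖ ≤ X) :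
    expectation p (fun ω => ∫ t in (0 : ℝ)..T,
        ‖trajectory (randomMatrix Asub p τ ω) B x₀ T u t
          - trajectory (fun _ => A) B x₀ T u t‖ ^ 2)
      ≤ errorConst T ‖op A‖ X * (gridSpacing τ * varA A Asub p) := by
  set x := trajectory (fun _ => A) B x₀ T u with hx
  set y : Sample M K → ℝ → EuclideanSpace ℝ (Fin N) :=
    fun ω => trajectory (randomMatrix Asub p τ ω) B x₀ T u with hy
  set V := varA A Asub p with hV
  set h := gridSpacing τ with hh
  set a := ‖op A‖ with ha
  have hxt : IsTrajectory (fun _ => A) B x₀ T u x := isTrajectory_const A B x₀ hT u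
  have hyt : ∀ ω, IsTrajectory (randomMatrix Asub p τ ω) B x₀ T u (y ω) := fun ω =>
    isTrajectory_randomMatrix Asub p hτ ω B x₀ u
  have hBu := Control.intervalIntegrable_norm_op hT B u
  have hxX : ∀ t ∈ Icc 0 T, ‖x t‖ ≤ X := fun t ht =>
    (hxt.norm_le (fun _ => inner_sum_nonpos hA hdis) hBu ht).trans hX
  have hyX : ∀ ω, ∀ t ∈ Icc 0 T, ‖y ω t‖ ≤ X := fun ω t ht =>
    ((hyt ω).norm_le (inner_randomMatrix_nonpos hdis hπ τ ω) hBu ht).trans hX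
  have hV0 : 0 ≤ V := varA_nonneg A Asub hp
  have hh0 : 0 ≤ h := hτ.gridSpacing_nonneg
  have ha0 : 0 ≤ a := norm_nonneg _
  set δ : Fin K → ℝ := fun k => τ k.succ - τ k.castSucc with hδ
  have hδ0 : ∀ k, 0 ≤ δ k := fun k =>
    sub_nonneg.2 (hτ.strictMono.monotone (Fin.castSucc_le_succ k))
  have hδh : ∀ k, δ k ≤ h := IsGrid.sub_le_gridSpacing τ
  have hδT : ∀ k, δ k ≤ T := fun k => by
    have := hτ.nonneg k.castSucc
    have := hτ.le k.succ
    simp only [hδ]; linarith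
  have hsubI : ∀ k : Fin K, Icc (τ k.castSucc) (τ k.succ) ⊆ Icc 0 T := fun k =>
    Icc_subset_Icc (hτ.nonneg _) (hτ.le _)
  have hprim : ∀ ω, IsPrimitive (fun t => y ω t - x t)
      (fun s => (op (randomMatrix Asub p τ ω s) (y ω s) + op B (u s))
        - (op A (x s) + op B (u s))) 0 T := fun ω =>
    ((hyt ω).isPrimitive hT).sub (hxt.isPrimitive hT)
  have step := fun (ω : Sample M K) (k : Fin K) =>
    error_step (inner_subsetMatrix_nonpos hdis hπ (ω k)) (sub_nonneg.1 (hδ0 k)) (hδh k) (hδT k)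
      (hxt.continuousOn.mono (hsubI k)) (fun t ht => hxX t (hsubI k ht))
      (fun t ht => hyX ω t (hsubI k ht))
      (((hprim ω).mono (hτ.nonneg _) (sub_nonneg.1 (hδ0 k)) (hτ.le _)).congr
        (sub_nonneg.1 (hδ0 k)) (by
          filter_upwards [ae_randomMatrix_eq Asub p hτ.strictMono ω k] with s hs hsI
          rw [hs hsI]; abel))
  set c := X ^ 2 * (5 * a * T + 2) with hc
  have hc0 : 0 ≤ c := by positivity
  set err : Fin (K + 1) → ℝ := fun k => expectation p fun ω => ‖y ω (τ k) - x (τ k)‖ ^ 2 with herr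
  have hvar := expectation_norm_sq_eq_varA (K := K) A Asub h1
  have herr_step : ∀ k : Fin K, err k.succ ≤ (1 + a * δ k) * err k.castSucc + δ k * (h * V * c) := by
    intro k
    set Y : Sample M K → EuclideanSpace ℝ (Fin N) :=
      fun ω => y ω (τ k.castSucc) - x (τ k.castSucc) with hYdef
    have hY : ∀ ω S, Y (Function.update ω k S) = Y ω := by
      intro ω S
      simp only [hYdef, hy, trajectory_update_eq Asub p hτ ω k S B x₀ u]
    have hz := expectation_inner_eq_zero hA h1 hπ k hY
      (∫ s in τ k.castSucc..τ k.succ, x s)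
    calc err k.succ ≤ expectation p (fun ω => (1 + a * δ k) * ‖Y ω‖ ^ 2
          + (2 * inner ℝ (Y ω) (op (subsetMatrix Asub p (ω k) - A)
              (∫ s in τ k.castSucc..τ k.succ, x s))
            + (δ k * h * c) * ‖op (subsetMatrix Asub p (ω k) - A)‖ ^ 2)) := by
          refine expectation_mono hp fun ω => ((step ω k).2).trans (le_of_eq ?_)
          simp only [hδ, hYdef, hc, ha]; ring
      _ = _ := by
          rw [expectation_add, expectation_add, expectation_const_mul, expectation_const_mul,
            expectation_const_mul, hz, hvar k]
          ring
  -- Discrete Gronwall: each factor `1 + a δ k` is at most `exp (a δ k)`, the error starts from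
  -- zero, and the sources add up to `τ k` times their rate.
  have herr_le : ∀ k, err k ≤ Real.exp (a * τ k) * (τ k * (h * V * c)) := by
    intro k
    induction k using Fin.induction with
    | zero =>
      have e0 : ∀ ω, y ω 0 - x 0 = 0 := fun ω => by
        rw [(hyt ω).apply_zero hT, hxt.apply_zero hT, sub_self]
      simp only [herr, hτ.zero, e0]
      simp [expectation]
    | succ k ih =>
      have hexp : (1 + a * δ k) * Real.exp (a * τ k.castSucc) ≤ Real.exp (a * τ k.succ) := by
        have : a * τ k.succ = a * δ k + a * τ k.castSucc := by simp only [hδ]; ring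
        rw [this, Real.exp_add]
        gcongr
        linarith [Real.add_one_le_exp (a * δ k)]
      have hexp1 : 1 ≤ Real.exp (a * τ k.succ) :=
        Real.one_le_exp (mul_nonneg ha0 (hτ.nonneg _))
      have hW : 0 ≤ h * V * c := by positivity
      have h2 : 0 ≤ 1 + a * δ k := by have := hδ0 k; positivity
      calc err k.succ ≤ (1 + a * δ k) * err k.castSucc + δ k * (h * V * c) := herr_step k
        _ ≤ (1 + a * δ k) * (Real.exp (a * τ k.castSucc) * (τ k.castSucc * (h * V * c)))
            + δ k * (h * V * c) := by gcongr
        _ = ((1 + a * δ k) * Real.exp (a * τ k.castSucc)) * (τ k.castSucc * (h * V * c))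
            + 1 * (δ k * (h * V * c)) := by ring
        _ ≤ Real.exp (a * τ k.succ) * (τ k.castSucc * (h * V * c))
            + Real.exp (a * τ k.succ) * (δ k * (h * V * c)) := by
            have := hτ.nonneg k.castSucc
            have := hδ0 k
            gcongr
        _ = _ := by simp only [hδ]; ring
  have hcont : ∀ ω, ContinuousOn (fun t => ‖y ω t - x t‖ ^ 2) (Icc 0 T) := fun ω =>
    ((hprim ω).continuousOn.norm).pow 2
  have hint : ∀ ω {r s : ℝ}, 0 ≤ r → r ≤ s → s ≤ T →
      IntervalIntegrable (fun t => ‖y ω t - x t‖ ^ 2) volume r s := by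
    intro ω r s hr hrs hs
    refine ((hcont ω).mono ?_).intervalIntegrable
    rw [uIcc_of_le hrs]; exact Icc_subset_Icc hr hs
  have hmain : ∀ k, expectation p (fun ω => ∫ t in (0 : ℝ)..τ k, ‖y ω t - x t‖ ^ 2)
      ≤ τ k * ((2 * (Real.exp (a * T) * (T * c)) + 8 * T * X ^ 2) * (h * V)) := by
    intro k
    induction k using Fin.induction with
    | zero => simp [hτ.zero, expectation]
    | succ k ih =>
      have hk := sub_nonneg.1 (hδ0 k)
      have hbound : ∀ ω, ∫ t in τ k.castSucc..τ k.succ, ‖y ω t - x t‖ ^ 2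
          ≤ (2 * δ k) * ‖y ω (τ k.castSucc) - x (τ k.castSucc)‖ ^ 2
            + (8 * δ k ^ 3 * X ^ 2) * ‖op (subsetMatrix Asub p (ω k) - A)‖ ^ 2 := by
        intro ω
        -- The pointwise bound of `error_step` is squared with `(r + s)² ≤ 2 (r² + s²)`; the `8` is
        -- `2 · 2²`.
        have := intervalIntegral.integral_mono_on (g := fun _ =>
          2 * ‖y ω (τ k.castSucc) - x (τ k.castSucc)‖ ^ 2
            + (8 * δ k ^ 2 * X ^ 2) * ‖op (subsetMatrix Asub p (ω k) - A)‖ ^ 2) hk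
          (hint ω (hτ.nonneg _) hk (hτ.le _)) intervalIntegrable_const (fun t ht => by
            have hs := (step ω k).1 t ht
            refine (pow_le_pow_left₀ (norm_nonneg _) hs 2).trans ?_
            refine (add_sq_le).trans (le_of_eq ?_)
            simp only [hδ]; ring)
        refine this.trans (le_of_eq ?_)
        rw [intervalIntegral.integral_const, smul_eq_mul]
        simp only [hδ]; ring
      have hτT := hτ.le k.castSucc
      have hτ0 := hτ.nonneg k.castSucc
      have hδk := hδ0 k
      have hδhk := hδh k
      have hδTk := hδT k
      calc expectation p (fun ω => ∫ t in (0 : ℝ)..τ k.succ, ‖y ω t - x t‖ ^ 2)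
          ≤ expectation p (fun ω => (∫ t in (0 : ℝ)..τ k.castSucc, ‖y ω t - x t‖ ^ 2)
            + ((2 * δ k) * ‖y ω (τ k.castSucc) - x (τ k.castSucc)‖ ^ 2
            + (8 * δ k ^ 3 * X ^ 2) * ‖op (subsetMatrix Asub p (ω k) - A)‖ ^ 2)) := by
            refine expectation_mono hp fun ω => ?_
            rw [← intervalIntegral.integral_add_adjacent_intervals
              (hint ω le_rfl hτ0 hτT) (hint ω hτ0 hk (hτ.le _))]
            linarith [hbound ω]
        _ = expectation p (fun ω => ∫ t in (0 : ℝ)..τ k.castSucc, ‖y ω t - x t‖ ^ 2)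
            + (2 * δ k * err k.castSucc + 8 * δ k ^ 3 * X ^ 2 * V) := by
            rw [expectation_add, expectation_add, expectation_const_mul, expectation_const_mul,
              hvar k]
        _ ≤ τ k.castSucc * ((2 * (Real.exp (a * T) * (T * c)) + 8 * T * X ^ 2) * (h * V))
            + (2 * δ k * (Real.exp (a * T) * (T * (h * V * c)))
              + 8 * (δ k * h * T) * X ^ 2 * V) := by
            have h3 : err k.castSucc ≤ Real.exp (a * T) * (T * (h * V * c)) := by
              refine (herr_le _).trans ?_
              gcongr
            -- One factor is kept for summation over the grid, one supplies the rate `h`, and one is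
            -- bounded by `T`.
            have h4 : δ k ^ 3 ≤ δ k * h * T := by
              rw [pow_succ, pow_two]; gcongr
            gcongr
        _ = _ := by simp only [hδ]; ring
  have hlast := hmain (Fin.last K)
  rw [hτ.last] at hlast
  refine hlast.trans (le_of_eq ?_)
  unfold errorConst
  ring

end ErrorEstimate

/-! ### The quadratic structure of the cost functional -/

/-- Bounded dissipative coefficients for which the state equation is solvable on `[0,T]`. -/
structure IsDissipativeSystem {N : ℕ} (F : ℝ → Matrix (Fin N) (Fin N) ℝ) (T : ℝ) : Prop where
  bounded : ∃ C, ∀ t, ‖op (F t)‖ ≤ C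
  dissipative : ∀ t x, inner ℝ x (op (F t) x) ≤ 0
  isTrajectory : ∀ {q : ℕ} (B : Matrix (Fin N) (Fin q) ℝ) (x₀ : EuclideanSpace ℝ (Fin N))
    (u : Control T q), IsTrajectory F B x₀ T u (trajectory F B x₀ T u)

theorem isDissipativeSystem_const {N : ℕ} {A : Matrix (Fin N) (Fin N) ℝ}
    (hA : ∀ x, inner ℝ x (op A x) ≤ 0) {T : ℝ} (hT : 0 ≤ T) :
    IsDissipativeSystem (fun _ => A) T :=
  ⟨⟨_, fun _ => le_rfl⟩, fun _ => hA, fun B x₀ u => isTrajectory_const A B x₀ hT u⟩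

theorem isDissipativeSystem_randomMatrix {N M K : ℕ} {Asub : Fin M → Matrix (Fin N) (Fin N) ℝ}
    {p : Finset (Fin M) → ℝ} (hdis : ∀ m x, inner ℝ x (op (Asub m) x) ≤ 0)
    (hπ : ∀ m, 0 < inclusionProb p m) {τ : Fin (K + 1) → ℝ} {T : ℝ} (hτ : IsGrid T τ)
    (ω : Sample M K) : IsDissipativeSystem (randomMatrix Asub p τ ω) T :=
  ⟨exists_norm_randomMatrix_le Asub p τ ω, inner_randomMatrix_nonpos hdis hπ τ ω,
    fun B x₀ u => isTrajectory_randomMatrix Asub p hτ ω B x₀ u⟩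

/-- Cauchy–Schwarz against the constant function, obtained by integrating `(f - c)² ≥ 0` with `c`
the mean of `f`. -/
theorem integral_sq_le {T : ℝ} (hT : 0 < T) {f : ℝ → ℝ}
    (hf : MemLp f 2 (volume.restrict (Ioc 0 T))) :
    (∫ t in (0 : ℝ)..T, f t) ^ 2 ≤ T * ∫ t in (0 : ℝ)..T, f t ^ 2 := by
  have h1 : IntervalIntegrable f volume 0 T :=
    (intervalIntegrable_iff_integrableOn_Ioc_of_le hT.le).2 (hf.integrable (by norm_num))
  have h2 : IntervalIntegrable (fun t => f t ^ 2) volume 0 T :=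
    (intervalIntegrable_iff_integrableOn_Ioc_of_le hT.le).2 hf.integrable_sq
  set c := (∫ t in (0 : ℝ)..T, f t) / T with hc
  have h3 : 0 ≤ ∫ t in (0 : ℝ)..T, (f t ^ 2 - 2 * c * f t + c ^ 2) :=
    intervalIntegral.integral_nonneg hT.le fun t _ => by nlinarith [sq_nonneg (f t - c)]
  rw [intervalIntegral.integral_add (h2.sub (h1.const_mul _)) intervalIntegrable_const,
    intervalIntegral.integral_sub h2 (h1.const_mul _), intervalIntegral.integral_const_mul,
    intervalIntegral.integral_const, smul_eq_mul, sub_zero] at h3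
  have h4 : ∫ t in (0 : ℝ)..T, f t = c * T := by rw [hc]; field_simp
  rw [h4] at h3 ⊢
  nlinarith

section Control

variable {T : ℝ} {q : ℕ}

theorem Control.norm_sq_eq (hT : 0 ≤ T) (u : Control T q) :
    ‖u‖ ^ 2 = ∫ t in (0 : ℝ)..T, ‖u t‖ ^ 2 := by
  rw [← real_inner_self_eq_norm_sq, L2.inner_def, intervalIntegral.integral_of_le hT]
  simp_rw [real_inner_self_eq_norm_sq]

theorem Control.sq_integral_norm_le (hT : 0 < T) (u : Control T q) :
    (∫ t in (0 : ℝ)..T, ‖u t‖) ^ 2 ≤ T * ‖u‖ ^ 2 := by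
  rw [Control.norm_sq_eq hT.le]
  exact integral_sq_le hT (Lp.memLp u).norm

theorem Control.integral_norm_op_le {N : ℕ} (hT : 0 ≤ T) (B : Matrix (Fin N) (Fin q) ℝ)
    (u : Control T q) : ∫ t in (0 : ℝ)..T, ‖op B (u t)‖ ≤ ‖op B‖ * ∫ t in (0 : ℝ)..T, ‖u t‖ := by
  rw [← intervalIntegral.integral_const_mul]
  exact intervalIntegral.integral_mono_on hT (Control.intervalIntegrable_norm_op hT B u)
    ((Control.intervalIntegrable hT u).norm.const_mul _) fun t _ => (op B).le_opNorm _

theorem Control.ae_add_smul (u v : Control T q) (θ : ℝ) :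
    ∀ᵐ t : ℝ, t ∈ Ioc 0 T → (u + θ • v : Control T q) t = u t + θ • v t := by
  have h : ∀ᵐ t ∂(volume.restrict (Ioc 0 T)), (u + θ • v : Control T q) t = u t + θ • v t := by
    filter_upwards [Lp.coeFn_add u (θ • v), Lp.coeFn_smul θ v] with t h1 h2
    rw [h1, Pi.add_apply, h2, Pi.smul_apply]
  exact (ae_restrict_iff' measurableSet_Ioc).1 h

end Control

theorem memLp_of_continuousOn {N : ℕ} {T : ℝ} {x : ℝ → EuclideanSpace ℝ (Fin N)}
    (hx : ContinuousOn x (Icc 0 T)) : MemLp x 2 (volume.restrict (Ioc 0 T)) := by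
  obtain ⟨C, hC⟩ := isCompact_Icc.exists_bound_of_continuousOn hx
  refine MemLp.of_bound ((hx.mono Ioc_subset_Icc_self).aestronglyMeasurable measurableSet_Ioc) C ?_
  exact (ae_restrict_iff' measurableSet_Ioc).2
    (Filter.Eventually.of_forall fun t ht => hC t (Ioc_subset_Icc_self ht))

theorem intervalIntegrable_inner_op {m n : ℕ} {T : ℝ} (hT : 0 ≤ T) (M : Matrix (Fin m) (Fin n) ℝ)
    {f : ℝ → EuclideanSpace ℝ (Fin m)} {g : ℝ → EuclideanSpace ℝ (Fin n)}
    (hf : MemLp f 2 (volume.restrict (Ioc 0 T))) (hg : MemLp g 2 (volume.restrict (Ioc 0 T))) :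
    IntervalIntegrable (fun t => inner ℝ (f t) (op M (g t))) volume 0 T :=
  (intervalIntegrable_iff_integrableOn_Ioc_of_le hT).2
    ((hf.norm.integrable_mul ((op M).comp_memLp' hg).norm).mono'
      (hf.1.inner ((op M).comp_memLp' hg).1)
      (Filter.Eventually.of_forall fun _ => norm_inner_le_norm _ _))

section System

variable {N q : ℕ} {F : ℝ → Matrix (Fin N) (Fin N) ℝ} {T : ℝ}
  (B : Matrix (Fin N) (Fin q) ℝ) (x₀ : EuclideanSpace ℝ (Fin N))

namespace IsDissipativeSystem

variable (hF : IsDissipativeSystem F T)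
include hF

theorem norm_trajectory_le (hT : 0 ≤ T) (u : Control T q) {t : ℝ} (ht : t ∈ Icc 0 T) :
    ‖trajectory F B x₀ T u t‖ ≤ ‖x₀‖ + 2 * ∫ s in (0 : ℝ)..T, ‖op B (u s)‖ :=
  (hF.isTrajectory B x₀ u).norm_le hF.dissipative (Control.intervalIntegrable_norm_op hT B u) ht

theorem memLp_trajectory (u : Control T q) :
    MemLp (trajectory F B x₀ T u) 2 (volume.restrict (Ioc 0 T)) :=
  memLp_of_continuousOn (hF.isTrajectory B x₀ u).continuousOn

theorem sq_norm_trajectory_le (hT : 0 < T) (v : Control T q) {t : ℝ} (ht : t ∈ Icc 0 T) :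
    ‖trajectory F B 0 T v t‖ ^ 2 ≤ 4 * ‖op B‖ ^ 2 * T * ‖v‖ ^ 2 := by
  have h1 := hF.norm_trajectory_le B 0 hT.le v ht
  have h2 := Control.integral_norm_op_le hT.le B v
  have h3 := Control.sq_integral_norm_le hT v
  rw [norm_zero, zero_add] at h1
  have h4 : ‖trajectory F B 0 T v t‖ ≤ 2 * (‖op B‖ * ∫ t in (0 : ℝ)..T, ‖v t‖) := by linarith
  calc _ ≤ (2 * (‖op B‖ * ∫ t in (0 : ℝ)..T, ‖v t‖)) ^ 2 := by gcongr
    _ = 4 * ‖op B‖ ^ 2 * (∫ t in (0 : ℝ)..T, ‖v t‖) ^ 2 := by ring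
    _ ≤ 4 * ‖op B‖ ^ 2 * (T * ‖v‖ ^ 2) := by gcongr
    _ = _ := by ring

theorem integral_sq_norm_trajectory_le (hT : 0 < T) (v : Control T q) :
    ∫ t in (0 : ℝ)..T, ‖trajectory F B 0 T v t‖ ^ 2 ≤ 4 * ‖op B‖ ^ 2 * T ^ 2 * ‖v‖ ^ 2 := by
  have h := intervalIntegral.integral_mono_on (μ := volume) hT.le
    ((intervalIntegrable_iff_integrableOn_Ioc_of_le hT.le).2
      (hF.memLp_trajectory B 0 v).norm.integrable_sq) intervalIntegrable_const
    fun t ht => hF.sq_norm_trajectory_le B hT v ht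
  refine h.trans (le_of_eq ?_)
  rw [intervalIntegral.integral_const, smul_eq_mul]
  ring

/-- The right-hand side solves the state equation for `u + θ • v`, up to the null set on which
representatives in `Lp` may fail to add; uniqueness of trajectories concludes. -/
theorem trajectory_add_smul (hT : 0 ≤ T) (u v : Control T q) (θ : ℝ) {t : ℝ} (ht : t ∈ Icc 0 T) :
    trajectory F B x₀ T (u + θ • v : Control T q) t
      = trajectory F B x₀ T u t + θ • trajectory F B 0 T v t := by
  obtain ⟨C, hC⟩ := hF.bounded
  refine (hF.isTrajectory B x₀ (u + θ • v)).eqOn (y := fun t => trajectory F B x₀ T u t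
    + θ • trajectory F B 0 T v t) hC ?_ ht
  have hu := hF.isTrajectory B x₀ u
  have hv := hF.isTrajectory B 0 v
  have hae : ∀ᵐ s : ℝ, s ∈ Ioc 0 T →
      (op (F s) (trajectory F B x₀ T u s) + op B (u s))
        + θ • (op (F s) (trajectory F B 0 T v s) + op B (v s))
      = op (F s) (trajectory F B x₀ T u s + θ • trajectory F B 0 T v s)
        + op B ((u + θ • v : Control T q) s) := by
    filter_upwards [Control.ae_add_smul u v θ] with s hs hsT
    rw [hs hsT, map_add, map_add, map_smul, map_smul, smul_add]
    abel
  have hP : IsPrimitive (fun t => trajectory F B x₀ T u t + θ • trajectory F B 0 T v t)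
      (fun s => (op (F s) (trajectory F B x₀ T u s) + op B (u s))
        + θ • (op (F s) (trajectory F B 0 T v s) + op B (v s))) 0 T := by
    refine ⟨hu.integrable.add (hv.integrable.smul θ), fun t ht => ?_⟩
    have hut := ((hu.isPrimitive hT).mono le_rfl ht.1 ht.2).integrable
    have hvt := ((hv.isPrimitive hT).mono le_rfl ht.1 ht.2).integrable
    rw [intervalIntegral.integral_add hut (hvt.continuousOn_smul continuousOn_const), intervalIntegral.integral_smul,
      hu.eq_integral t ht, hv.eq_integral t ht, hu.apply_zero hT, hv.apply_zero hT]
    simp only [zero_add, smul_zero, add_zero]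
    abel
  have hP' := hP.congr hT hae
  refine ⟨hP.continuousOn, hP'.integrable, fun t ht => ?_⟩
  rw [hP'.eq_integral t ht, hu.apply_zero hT, hv.apply_zero hT]
  simp

end IsDissipativeSystem

variable (Q : Matrix (Fin N) (Fin N) ℝ) (R : Matrix (Fin q) (Fin q) ℝ)

/-- The derivative of the cost functional at `u` in the direction `v`. -/
def costDeriv (F : ℝ → Matrix (Fin N) (Fin N) ℝ) (xd : ℝ → EuclideanSpace ℝ (Fin N))
    (u v : Control T q) : ℝ :=
  ∫ t in (0 : ℝ)..T, (inner ℝ (trajectory F B x₀ T u t - xd t) (op Q (trajectory F B 0 T v t))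
    + inner ℝ (u t) (op R (v t)))

/-- Half the second derivative of the cost functional in the direction `v`. -/
def costHess (F : ℝ → Matrix (Fin N) (Fin N) ℝ) (v : Control T q) : ℝ :=
  (1 / 2) * ∫ t in (0 : ℝ)..T, (inner ℝ (trajectory F B 0 T v t) (op Q (trajectory F B 0 T v t))
    + inner ℝ (v t) (op R (v t)))

theorem costHess_nonneg {Q : Matrix (Fin N) (Fin N) ℝ} {R : Matrix (Fin q) (Fin q) ℝ} (hT : 0 ≤ T) (hQ : Q.PosSemidef)
    (hR : R.PosSemidef) (F : ℝ → Matrix (Fin N) (Fin N) ℝ) (v : Control T q) :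
    0 ≤ costHess B Q R F v :=
  mul_nonneg (by norm_num) (intervalIntegral.integral_nonneg hT fun t _ =>
    add_nonneg (inner_op_nonneg hQ _) (inner_op_nonneg hR _))

variable {Q R} {xd : ℝ → EuclideanSpace ℝ (Fin N)}

namespace IsDissipativeSystem

variable (hF : IsDissipativeSystem F T)
include hF

/-- The state depends affinely on the control, so the expansion is exact. Symmetry of `Q` and `R`
merges the two cross terms into one. -/
theorem cost_add_smul (hT : 0 ≤ T) (hQ : Q.PosSemidef) (hR : R.PosSemidef)
    (hxd : MemLp xd 2 (volume.restrict (Ioc 0 T))) (u v : Control T q) (θ : ℝ) :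
    cost F B x₀ Q R xd T (u + θ • v) = cost F B x₀ Q R xd T u
      + θ * costDeriv B x₀ Q R F xd u v + θ ^ 2 * costHess B Q R F v := by
  set x := trajectory F B x₀ T u with hx
  set y := trajectory F B 0 T v with hy
  have hxm : MemLp (fun t => x t - xd t) 2 (volume.restrict (Ioc 0 T)) :=
    (hF.memLp_trajectory B x₀ u).sub hxd
  have hym := hF.memLp_trajectory B 0 v
  have i1 := (intervalIntegrable_inner_op hT Q hxm hxm).add
    (intervalIntegrable_inner_op hT R (Lp.memLp u) (Lp.memLp u))
  have i2 := (intervalIntegrable_inner_op hT Q hxm hym).add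
    (intervalIntegrable_inner_op hT R (Lp.memLp u) (Lp.memLp v))
  have i3 := (intervalIntegrable_inner_op hT Q hym hym).add
    (intervalIntegrable_inner_op hT R (Lp.memLp v) (Lp.memLp v))
  have e : cost F B x₀ Q R xd T (u + θ • v) = (1 / 2) * ∫ t in (0 : ℝ)..T,
      ((inner ℝ (x t - xd t) (op Q (x t - xd t)) + inner ℝ (u t) (op R (u t)))
      + ((2 * θ) * (inner ℝ (x t - xd t) (op Q (y t)) + inner ℝ (u t) (op R (v t)))
      + θ ^ 2 * (inner ℝ (y t) (op Q (y t)) + inner ℝ (v t) (op R (v t))))) := by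
    unfold cost
    congr 1
    refine intervalIntegral.integral_congr_ae ?_
    filter_upwards [Control.ae_add_smul u v θ] with t ht htT
    rw [uIoc_of_le hT] at htT
    rw [ht htT, hF.trajectory_add_smul B x₀ hT u v θ (Ioc_subset_Icc_self htT), ← hx, ← hy,
      add_sub_right_comm]
    simp only [map_add, map_smul, inner_add_left, inner_add_right, real_inner_smul_left,
      real_inner_smul_right]
    rw [real_inner_comm _ (y t), inner_op_comm hQ, real_inner_comm _ (v t), inner_op_comm hR]
    ring
  rw [e, intervalIntegral.integral_add i1 ((i2.const_mul _).add (i3.const_mul _)),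
    intervalIntegral.integral_add (i2.const_mul _) (i3.const_mul _),
    intervalIntegral.integral_const_mul, intervalIntegral.integral_const_mul]
  unfold cost costDeriv costHess
  ring

theorem costHess_le (hT : 0 < T) (v : Control T q) :
    costHess B Q R F v
      ≤ (1 / 2) * (‖op Q‖ * (4 * ‖op B‖ ^ 2 * T ^ 2) + ‖op R‖) * ‖v‖ ^ 2 := by
  set y := trajectory F B 0 T v with hy
  have hym := hF.memLp_trajectory B 0 v
  have hv := Lp.memLp v
  have j1 : IntervalIntegrable (fun t => ‖y t‖ ^ 2) volume 0 T :=
    (intervalIntegrable_iff_integrableOn_Ioc_of_le hT.le).2 hym.norm.integrable_sq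
  have j2 : IntervalIntegrable (fun t => ‖v t‖ ^ 2) volume 0 T :=
    (intervalIntegrable_iff_integrableOn_Ioc_of_le hT.le).2 hv.norm.integrable_sq
  have h := intervalIntegral.integral_mono_on hT.le
    ((intervalIntegrable_inner_op hT.le Q hym hym).add
      (intervalIntegrable_inner_op hT.le R hv hv))
    ((j1.const_mul ‖op Q‖).add (j2.const_mul ‖op R‖)) fun t _ => by
      have h1 := inner_op_le Q (y t) (y t)
      have h2 := inner_op_le R (v t) (v t)
      rw [← pow_two] at h1 h2
      exact add_le_add h1 h2
  rw [intervalIntegral.integral_add (j1.const_mul _) (j2.const_mul _),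
    intervalIntegral.integral_const_mul, intervalIntegral.integral_const_mul,
    ← Control.norm_sq_eq hT.le] at h
  have h3 := mul_le_mul_of_nonneg_left (hF.integral_sq_norm_trajectory_le B hT v)
    (norm_nonneg (op Q))
  unfold costHess
  rw [← hy] at h3 ⊢
  linarith

/-- Minimality makes `θ L + θ² H` nonnegative for every `θ`, which forces `L = 0`. The test value
uses `H + 1` as denominator because `H` may vanish. -/
theorem costDeriv_eq_zero (hT : 0 ≤ T) (hQ : Q.PosSemidef) (hR : R.PosSemidef)
    (hxd : MemLp xd 2 (volume.restrict (Ioc 0 T))) {u : Control T q}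
    (hu : IsMinOn (cost F B x₀ Q R xd T) univ u) (v : Control T q) :
    costDeriv B x₀ Q R F xd u v = 0 := by
  set L := costDeriv B x₀ Q R F xd u v
  set H := costHess B Q R F v
  have hH : 0 ≤ H := costHess_nonneg B hT hQ hR F v
  have h : ∀ θ : ℝ, 0 ≤ θ * L + θ ^ 2 * H := fun θ => by
    have h1 : cost F B x₀ Q R xd T u ≤ cost F B x₀ Q R xd T (u + θ • v) := hu (mem_univ _)
    rw [hF.cost_add_smul B x₀ hT hQ hR hxd] at h1
    linarith
  have h2 := h (-L / (H + 1))
  have h3 : -L / (H + 1) * L + (-L / (H + 1)) ^ 2 * H = -(L ^ 2 / (H + 1) ^ 2) := by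
    field_simp; ring
  rw [h3] at h2
  have h4 : 0 ≤ L ^ 2 / (H + 1) ^ 2 := by positivity
  have h5 : L ^ 2 / (H + 1) ^ 2 = 0 := by linarith
  have h6 : (H + 1) ^ 2 ≠ 0 := by positivity
  simpa [h6] using h5

/-- For a quadratic functional the convexity gap at the midpoint of `0` and `v` is exactly a quarter
of the second-order term, while strong convexity makes it at least `α / 8 * ‖v‖ ^ 2`. -/
theorem le_costHess_of_strongConvexOn (hT : 0 ≤ T) (hQ : Q.PosSemidef) (hR : R.PosSemidef)
    (hxd : MemLp xd 2 (volume.restrict (Ioc 0 T))) {α : ℝ}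
    (hα : StrongConvexOn univ α (cost F B x₀ Q R xd T)) (v : Control T q) :
    α / 2 * ‖v‖ ^ 2 ≤ costHess B Q R F v := by
  obtain ⟨-, h⟩ := hα
  replace h := h (mem_univ (0 : Control T q)) (mem_univ (0 + (1 : ℝ) • v)) (a := 1 / 2)
    (b := 1 / 2) (by norm_num) (by norm_num) (by norm_num)
  have e : ((1 / 2 : ℝ) • (0 : Control T q) + (1 / 2 : ℝ) • (0 + (1 : ℝ) • v)) =
      0 + (1 / 2 : ℝ) • v := by simp
  rw [e, hF.cost_add_smul B x₀ hT hQ hR hxd, hF.cost_add_smul B x₀ hT hQ hR hxd] at h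
  simp only [one_smul, zero_add, zero_sub, norm_neg, smul_eq_mul] at h
  linarith

end IsDissipativeSystem

end System

/-! ### Time reversal and the adjoint equation -/

theorem ae_comp_sub_left {P : ℝ → Prop} (T : ℝ) (h : ∀ᵐ s : ℝ, P s) : ∀ᵐ s : ℝ, P (T - s) :=
  (Measure.measurePreserving_sub_left volume T).quasiMeasurePreserving.ae h

/-- Reflection exchanges `Ico 0 T` and `Ioc 0 T`, which agree up to a null set. -/
theorem measurePreserving_sub_left_Ioc (T : ℝ) :
    MeasurePreserving (fun t => T - t) (volume.restrict (Ioc 0 T)) (volume.restrict (Ioc 0 T)) := by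
  have h := (Measure.measurePreserving_sub_left volume T).restrict_preimage
    (s := Ico 0 T) measurableSet_Ico
  have e : (fun t : ℝ => T - t) ⁻¹' Ico 0 T = Ioc 0 T := by
    ext t; simp only [mem_preimage, mem_Ico, mem_Ioc]; constructor <;> rintro ⟨h1, h2⟩ <;>
      constructor <;> linarith
  rwa [e, Measure.restrict_congr_set (Ico_ae_eq_Ioc (μ := volume) (a := (0 : ℝ)) (b := T))] at h

/-- The time reversal of a square integrable function on `(0,T)`. -/
def reversal {N : ℕ} {T : ℝ} {g : ℝ → EuclideanSpace ℝ (Fin N)}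
    (hg : MemLp g 2 (volume.restrict (Ioc 0 T))) : Control T N :=
  (hg.comp_measurePreserving (measurePreserving_sub_left_Ioc T)).toLp

theorem ae_reversal_eq {N : ℕ} {T : ℝ} {g : ℝ → EuclideanSpace ℝ (Fin N)}
    (hg : MemLp g 2 (volume.restrict (Ioc 0 T))) :
    ∀ᵐ s : ℝ, s ∈ Ioc 0 T → reversal hg s = g (T - s) :=
  (ae_restrict_iff' measurableSet_Ioc).1 (MemLp.coeFn_toLp _)

theorem integral_norm_reversal {N : ℕ} {T : ℝ} (hT : 0 ≤ T) {g : ℝ → EuclideanSpace ℝ (Fin N)}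
    (hg : MemLp g 2 (volume.restrict (Ioc 0 T))) :
    ∫ s in (0 : ℝ)..T, ‖op (1 : Matrix (Fin N) (Fin N) ℝ) (reversal hg s)‖ = ∫ s in (0 : ℝ)..T, ‖g s‖ := by
  have h := intervalIntegral.integral_comp_sub_left (a := 0) (b := T) (fun s => ‖g s‖) T
  rw [sub_self, sub_zero] at h
  rw [← h]
  refine intervalIntegral.integral_congr_ae ?_
  filter_upwards [ae_reversal_eq hg] with s hs hsT
  rw [uIoc_of_le hT] at hsT
  rw [op_one_apply, hs hsT]

theorem IsPrimitive.reverse {N : ℕ} {z g : ℝ → EuclideanSpace ℝ (Fin N)} {T : ℝ}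
    (hz : IsPrimitive z g 0 T) :
    IsPrimitive (fun t => z (T - t)) (fun t => -g (T - t)) 0 T where
  integrable := by
    have := (hz.integrable.comp_sub_left T).neg
    rw [sub_self, sub_zero] at this
    exact this.symm
  eq_integral := by
    intro t ht
    have h1 : T - t ∈ Icc 0 T := ⟨by linarith [ht.2], by linarith [ht.1]⟩
    have h2 := (hz.mono h1.1 h1.2 le_rfl).eq_integral T ⟨h1.2, le_rfl⟩
    rw [intervalIntegral.integral_neg, intervalIntegral.integral_comp_sub_left (fun s => g s) T,
      sub_zero, h2]
    abel

section Duality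

variable {N q : ℕ} {F G : ℝ → Matrix (Fin N) (Fin N) ℝ} {T : ℝ}

/-- The adjoint of the control-to-state map, in terms of the time-reversed adjoint equation. -/
theorem integral_inner_trajectory_eq (hF : IsDissipativeSystem F T) (hG : IsDissipativeSystem G T)
    (hT : 0 ≤ T) (hFG : ∀ᵐ s : ℝ, s ∈ Ioc 0 T → G s = (F (T - s)).transpose)
    (B : Matrix (Fin N) (Fin q) ℝ) {g : ℝ → EuclideanSpace ℝ (Fin N)}
    (hg : MemLp g 2 (volume.restrict (Ioc 0 T))) (v : Control T q) :
    ∫ t in (0 : ℝ)..T, inner ℝ (g t) (trajectory F B 0 T v t)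
      = ∫ t in (0 : ℝ)..T, inner ℝ (trajectory G 1 0 T (reversal hg) (T - t)) (op B (v t)) := by
  set ψ := trajectory G 1 0 T (reversal hg) with hψ
  set y := trajectory F B 0 T v with hy
  have hψt : IsTrajectory G 1 0 T (reversal hg) ψ := hG.isTrajectory 1 0 (reversal hg)
  have hyt : IsTrajectory F B 0 T v y := hF.isTrajectory B 0 v
  have hae : ∀ᵐ s : ℝ, s ∈ Ioc 0 T →
      -(op (G (T - s)) (ψ (T - s)) + op 1 (reversal hg (T - s)))
        = -(op (F s).transpose (ψ (T - s)) + g s) := by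
    -- At `s = T` the reflected time is `0`, outside `Ioc 0 T`, where nothing is known about `G` and
    -- the reversed input.
    have hne : ∀ᵐ s : ℝ, s ≠ T := by simp [ae_iff]
    filter_upwards [ae_comp_sub_left T hFG, ae_comp_sub_left T (ae_reversal_eq hg), hne]
      with s h1 h2 h3 hs
    have hs' : T - s ∈ Ioc 0 T :=
      ⟨sub_pos.2 (lt_of_le_of_ne hs.2 h3), by linarith [hs.1]⟩
    rw [h1 hs', h2 hs', op_one_apply, sub_sub_cancel]
  have hP := ((hψt.isPrimitive hT).reverse).congr hT hae
  have hY := hyt.isPrimitive hT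
  -- Both boundary terms vanish: the state is zero at time `0` and the adjoint state is zero at time
  -- `T`. In the integrand the two terms containing `F` cancel by transposition.
  have key := hP.integral_inner_add_inner hY hT
  simp only [sub_self, hψt.apply_zero hT, hyt.apply_zero hT, inner_zero_left, inner_zero_right]
    at key
  have hgi : IntervalIntegrable g volume 0 T :=
    (intervalIntegrable_iff_integrableOn_Ioc_of_le hT).2 (hg.integrable (by norm_num))
  have hvi := Control.intervalIntegrable hT v
  have hBv : IntervalIntegrable (fun s => op B (v s)) volume 0 T :=
    ⟨(op B).integrable_comp hvi.1, (op B).integrable_comp hvi.2⟩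
  have i1 := intervalIntegrable_inner_continuousOn hT hgi hY.continuousOn
  have i2 := intervalIntegrable_continuousOn_inner hT hBv hP.continuousOn
  rw [← sub_eq_zero, ← neg_eq_zero, ← intervalIntegral.integral_sub i1 i2,
    ← intervalIntegral.integral_neg]
  refine Eq.trans ?_ key
  congr 1
  ext s
  rw [inner_neg_left, inner_add_left, inner_add_right, inner_op_left,
    Matrix.transpose_transpose]
  ring

/-- The sensitivity of the derivative of the cost functional to the coefficients. -/
theorem costDeriv_sub_le {F₀ G₀ : ℝ → Matrix (Fin N) (Fin N) ℝ} (hF : IsDissipativeSystem F T)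
    (hG : IsDissipativeSystem G T) (hF₀ : IsDissipativeSystem F₀ T)
    (hG₀ : IsDissipativeSystem G₀ T) (hT : 0 < T)
    (hFG : ∀ᵐ s : ℝ, s ∈ Ioc 0 T → G s = (F (T - s)).transpose)
    (hFG₀ : ∀ᵐ s : ℝ, s ∈ Ioc 0 T → G₀ s = (F₀ (T - s)).transpose)
    (B : Matrix (Fin N) (Fin q) ℝ) (x₀ : EuclideanSpace ℝ (Fin N))
    {Q : Matrix (Fin N) (Fin N) ℝ} (hQ : Q.PosSemidef) (R : Matrix (Fin q) (Fin q) ℝ)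
    {xd : ℝ → EuclideanSpace ℝ (Fin N)} (hxd : MemLp xd 2 (volume.restrict (Ioc 0 T)))
    (u v : Control T q) {g : ℝ → EuclideanSpace ℝ (Fin N)}
    (hg : MemLp g 2 (volume.restrict (Ioc 0 T)))
    (hgdef : ∀ t, g t = op Q (trajectory F₀ B x₀ T u t - xd t))
    {α : ℝ} (hα : 0 < α) :
    costDeriv B x₀ Q R F xd u v - costDeriv B x₀ Q R F₀ xd u v
      ≤ α / 2 * ‖v‖ ^ 2 + α⁻¹ * ((4 * ‖op B‖ ^ 2 * T ^ 2 + 1) * ‖op Q‖ ^ 2 *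
          (∫ t in (0 : ℝ)..T, ‖trajectory F B x₀ T u t - trajectory F₀ B x₀ T u t‖ ^ 2)
        + ‖op B‖ ^ 2 * ∫ t in (0 : ℝ)..T,
          ‖trajectory G 1 0 T (reversal hg) t - trajectory G₀ 1 0 T (reversal hg) t‖ ^ 2) := by
  -- The first summand bounds `∫ ‖y‖²` relative to `‖v‖²`; the added `1` keeps the Young weight `α /
  -- (4 κ)` defined when `B = 0`.
  set κ := 4 * ‖op B‖ ^ 2 * T ^ 2 + 1 with hκ
  have hκ0 : 0 < κ := by positivity
  set x := trajectory F B x₀ T u with hx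
  set x' := trajectory F₀ B x₀ T u with hx'
  set y := trajectory F B 0 T v with hy
  set y' := trajectory F₀ B 0 T v with hy'
  set ψ := trajectory G 1 0 T (reversal hg) with hψ
  set ψ' := trajectory G₀ 1 0 T (reversal hg) with hψ'
  have mx : MemLp (fun t => x t - xd t) 2 (volume.restrict (Ioc 0 T)) :=
    (hF.memLp_trajectory B x₀ u).sub hxd
  have mx' : MemLp (fun t => x' t - xd t) 2 (volume.restrict (Ioc 0 T)) :=
    (hF₀.memLp_trajectory B x₀ u).sub hxd
  have me : MemLp (fun t => x t - x' t) 2 (volume.restrict (Ioc 0 T)) :=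
    (hF.memLp_trajectory B x₀ u).sub (hF₀.memLp_trajectory B x₀ u)
  have my := hF.memLp_trajectory B 0 v
  have my' := hF₀.memLp_trajectory B 0 v
  have mv := Lp.memLp v
  have mψ : MemLp (fun t => ψ t - ψ' t) 2 (volume.restrict (Ioc 0 T)) :=
    (hG.memLp_trajectory 1 0 _).sub (hG₀.memLp_trajectory 1 0 _)
  have mψr : MemLp (fun t => ψ (T - t) - ψ' (T - t)) 2 (volume.restrict (Ioc 0 T)) :=
    mψ.comp_measurePreserving (measurePreserving_sub_left_Ioc T)
  have mψ1 : MemLp (fun t => ψ (T - t)) 2 (volume.restrict (Ioc 0 T)) :=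
    (hG.memLp_trajectory 1 0 _).comp_measurePreserving (measurePreserving_sub_left_Ioc T)
  have mψ2 : MemLp (fun t => ψ' (T - t)) 2 (volume.restrict (Ioc 0 T)) :=
    (hG₀.memLp_trajectory 1 0 _).comp_measurePreserving (measurePreserving_sub_left_Ioc T)
  have sqi : ∀ {n : ℕ} {f : ℝ → EuclideanSpace ℝ (Fin n)},
      MemLp f 2 (volume.restrict (Ioc 0 T)) →
      IntervalIntegrable (fun t => ‖f t‖ ^ 2) volume 0 T := fun hf =>
    (intervalIntegrable_iff_integrableOn_Ioc_of_le hT.le).2 hf.norm.integrable_sq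
  have iR := intervalIntegrable_inner_op hT.le R (Lp.memLp u) mv
  have i1 := intervalIntegrable_inner_op hT.le Q mx my
  have i1' := intervalIntegrable_inner_op hT.le Q mx' my'
  have i2 := intervalIntegrable_inner_op hT.le Q me my
  have i3 := intervalIntegrable_inner_op hT.le Q mx' my
  have d1 := integral_inner_trajectory_eq hF hG hT.le hFG B hg v
  have d2 := integral_inner_trajectory_eq hF₀ hG₀ hT.le hFG₀ B hg v
  simp_rw [hgdef, inner_op_comm hQ] at d1 d2
  -- The control terms cancel. The difference of responses `y - y'` is paired with the fixed
  -- function `g` and is exchanged for the adjoint error `ψ - ψ'`, which does not involve `v`.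
  have split : costDeriv B x₀ Q R F xd u v - costDeriv B x₀ Q R F₀ xd u v
      = (∫ t in (0 : ℝ)..T, inner ℝ (x t - x' t) (op Q (y t)))
        + ∫ t in (0 : ℝ)..T, inner ℝ (ψ (T - t) - ψ' (T - t)) (op B (v t)) := by
    unfold costDeriv
    rw [← hx, ← hx', ← hy, ← hy', intervalIntegral.integral_add i1 iR,
      intervalIntegral.integral_add i1' iR]
    have e1 : ∫ t in (0 : ℝ)..T, inner ℝ (ψ (T - t) - ψ' (T - t)) (op B (v t))
        = (∫ t in (0 : ℝ)..T, inner ℝ (x' t - xd t) (op Q (y t)))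
          - ∫ t in (0 : ℝ)..T, inner ℝ (x' t - xd t) (op Q (y' t)) := by
      rw [d1, d2, ← intervalIntegral.integral_sub
        (intervalIntegrable_inner_op hT.le B mψ1 mv) (intervalIntegrable_inner_op hT.le B mψ2 mv)]
      simp_rw [inner_sub_left]
    have e2 : ∫ t in (0 : ℝ)..T, inner ℝ (x t - xd t) (op Q (y t))
        = (∫ t in (0 : ℝ)..T, inner ℝ (x t - x' t) (op Q (y t)))
          + ∫ t in (0 : ℝ)..T, inner ℝ (x' t - xd t) (op Q (y t)) := by
      rw [← intervalIntegral.integral_add i2 i3]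
      congr 1; ext t; rw [← inner_add_left]; congr 1; abel
    rw [e1, e2]; ring
  -- Young's inequality is weighted here and in `b2` so that each integral spends `α / 4 * ‖v‖ ^ 2`.
  have b1 : ∫ t in (0 : ℝ)..T, inner ℝ (x t - x' t) (op Q (y t))
      ≤ ∫ t in (0 : ℝ)..T, (α / (4 * κ) * ‖y t‖ ^ 2 + α⁻¹ * (κ * ‖op Q‖ ^ 2) * ‖x t - x' t‖ ^ 2) := by
    refine intervalIntegral.integral_mono_on hT.le i2
      (((sqi my).const_mul _).add ((sqi me).const_mul _)) fun t _ => (inner_op_le Q _ _).trans ?_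
    have e : α / (4 * κ) * ‖y t‖ ^ 2 + α⁻¹ * (κ * ‖op Q‖ ^ 2) * ‖x t - x' t‖ ^ 2
        - ‖op Q‖ * (‖x t - x' t‖ * ‖y t‖)
        = (α * ‖y t‖ - 2 * κ * (‖op Q‖ * ‖x t - x' t‖)) ^ 2 / (4 * κ * α) := by
      field_simp; ring
    have e' : 0 ≤ (α * ‖y t‖ - 2 * κ * (‖op Q‖ * ‖x t - x' t‖)) ^ 2 / (4 * κ * α) := by positivity
    linarith
  have b2 : ∫ t in (0 : ℝ)..T, inner ℝ (ψ (T - t) - ψ' (T - t)) (op B (v t))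
      ≤ ∫ t in (0 : ℝ)..T, (α / 4 * ‖v t‖ ^ 2
        + α⁻¹ * ‖op B‖ ^ 2 * ‖ψ (T - t) - ψ' (T - t)‖ ^ 2) := by
    refine intervalIntegral.integral_mono_on hT.le (intervalIntegrable_inner_op hT.le B mψr mv)
      (((sqi mv).const_mul _).add ((sqi mψr).const_mul _)) fun t _ => (inner_op_le B _ _).trans ?_
    set d := ‖ψ (T - t) - ψ' (T - t)‖
    have e : α / 4 * ‖v t‖ ^ 2 + α⁻¹ * ‖op B‖ ^ 2 * d ^ 2 - ‖op B‖ * (d * ‖v t‖)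
        = (α * ‖v t‖ - 2 * (‖op B‖ * d)) ^ 2 / (4 * α) := by
      field_simp; ring
    have e' : 0 ≤ (α * ‖v t‖ - 2 * (‖op B‖ * d)) ^ 2 / (4 * α) := by positivity
    linarith
  rw [intervalIntegral.integral_add ((sqi my).const_mul _) ((sqi me).const_mul _),
    intervalIntegral.integral_const_mul, intervalIntegral.integral_const_mul] at b1
  have hrev := intervalIntegral.integral_comp_sub_left (a := 0) (b := T)
    (fun s => ‖ψ s - ψ' s‖ ^ 2) T
  rw [sub_self, sub_zero] at hrev
  rw [intervalIntegral.integral_add ((sqi mv).const_mul _) ((sqi mψr).const_mul _),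
    intervalIntegral.integral_const_mul, intervalIntegral.integral_const_mul,
    ← Control.norm_sq_eq hT.le, hrev] at b2
  have hyb : α / (4 * κ) * ∫ t in (0 : ℝ)..T, ‖y t‖ ^ 2 ≤ α / 4 * ‖v‖ ^ 2 := by
    have h := hF.integral_sq_norm_trajectory_le B hT v
    calc α / (4 * κ) * ∫ t in (0 : ℝ)..T, ‖y t‖ ^ 2 ≤ α / (4 * κ) * (κ * ‖v‖ ^ 2) := by
          gcongr
          refine h.trans ?_
          gcongr
          linarith
      _ = _ := by field_simp
  rw [split]
  linarith

end Duality

/-! ### The reversed grid -/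

section Reversal

variable {N M K : ℕ} {T : ℝ} {τ : Fin (K + 1) → ℝ}

/-- The grid obtained by reversing time. -/
def reverseGrid (T : ℝ) (τ : Fin (K + 1) → ℝ) (k : Fin (K + 1)) : ℝ := T - τ k.rev

theorem IsGrid.reverse (hτ : IsGrid T τ) : IsGrid T (reverseGrid T τ) where
  zero := by simp [reverseGrid, hτ.last]
  last := by simp [reverseGrid, hτ.zero]
  strictMono := fun i j hij => sub_lt_sub_left (hτ.strictMono (Fin.rev_lt_rev.2 hij)) T

theorem gridSpacing_reverseGrid : gridSpacing (reverseGrid T τ) = gridSpacing τ := by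
  unfold gridSpacing reverseGrid
  rw [← Fin.revPerm.iSup_comp (g := fun k : Fin K => τ k.succ - τ k.castSucc)]
  refine iSup_congr fun k => ?_
  rw [Fin.revPerm_apply, Fin.rev_succ, Fin.rev_castSucc]
  ring

/-- The selections are identically distributed, so reversing their order permutes the factors of the
product weight. -/
theorem expectation_comp_rev (p : Finset (Fin M) → ℝ) (X : Sample M K → ℝ) :
    expectation p (fun ω => X (ω ∘ Fin.rev)) = expectation p X := by
  unfold expectation
  rw [← (Fin.revPerm.arrowCongr (Equiv.refl (Finset (Fin M)))).sum_comp]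
  refine Finset.sum_congr rfl fun ω _ => ?_
  congr 1
  · exact congrArg X (funext fun k => by simp)
  · rw [← Equiv.prod_comp Fin.revPerm]
    simp

theorem subsetMatrix_transpose (Asub : Fin M → Matrix (Fin N) (Fin N) ℝ) (p : Finset (Fin M) → ℝ)
    (S : Finset (Fin M)) :
    subsetMatrix (fun m => (Asub m).transpose) p S = (subsetMatrix Asub p S).transpose := by
  simp [subsetMatrix, Matrix.transpose_sum]

theorem varA_transpose (A : Matrix (Fin N) (Fin N) ℝ) (Asub : Fin M → Matrix (Fin N) (Fin N) ℝ)
    (p : Finset (Fin M) → ℝ) :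
    varA A.transpose (fun m => (Asub m).transpose) p = varA A Asub p := by
  unfold varA
  refine Finset.sum_congr rfl fun S _ => ?_
  rw [subsetMatrix_transpose, ← Matrix.transpose_sub, norm_op_transpose]

theorem inner_transpose_nonpos {A : Matrix (Fin N) (Fin N) ℝ}
    (hA : ∀ x, inner ℝ x (op A x) ≤ 0) (x : EuclideanSpace ℝ (Fin N)) :
    inner ℝ x (op A.transpose x) ≤ 0 := by
  rw [← inner_op_left, real_inner_comm]; exact hA x

/-- Reflection moves the closed end of each half-open interval to the other side, so the identity
can fail only at the reflected grid points. It shows that the reversed adjoint system is again a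
randomized system of the same kind. -/
theorem ae_randomMatrix_reverse (Asub : Fin M → Matrix (Fin N) (Fin N) ℝ)
    (p : Finset (Fin M) → ℝ) (T : ℝ) (τ : Fin (K + 1) → ℝ) (ω : Sample M K) :
    ∀ᵐ s : ℝ, randomMatrix (fun m => (Asub m).transpose) p (reverseGrid T τ) (ω ∘ Fin.rev) s
      = (randomMatrix Asub p τ ω (T - s)).transpose := by
  have hne : ∀ᵐ s : ℝ, ∀ j : Fin (K + 1), T - s ≠ τ j :=
    ae_all_iff.2 fun j => ae_comp_sub_left (P := fun s => s ≠ τ j) T (by simp [ae_iff])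
  filter_upwards [hne] with s hs
  unfold randomMatrix
  rw [Matrix.transpose_sum, ← Equiv.sum_comp Fin.revPerm]
  refine Finset.sum_congr rfl fun k _ => ?_
  simp only [Fin.revPerm_apply, reverseGrid, Fin.rev_succ, Fin.rev_castSucc, Fin.rev_rev,
    Function.comp_apply, subsetMatrix_transpose]
  have hiff : s ∈ Ico (T - τ k.succ) (T - τ k.castSucc)
      ↔ T - s ∈ Ico (τ k.castSucc) (τ k.succ) := by
    constructor
    · rintro ⟨h1, h2⟩
      exact ⟨by linarith, lt_of_le_of_ne (by linarith) (hs k.succ)⟩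
    · rintro ⟨h1, h2⟩
      exact ⟨by linarith, by have := lt_of_le_of_ne h1 (hs k.castSucc).symm; linarith⟩
  by_cases h : T - s ∈ Ico (τ k.castSucc) (τ k.succ)
  · rw [indicator_of_mem h, indicator_of_mem (hiff.2 h)]
  · rw [indicator_of_notMem h, indicator_of_notMem (fun h' => h (hiff.1 h'))]
    simp

end Reversal

/-! ### Bounds for the optimal control -/

section Optimality

variable {N q : ℕ} {F : ℝ → Matrix (Fin N) (Fin N) ℝ} {T : ℝ} {B : Matrix (Fin N) (Fin q) ℝ}
  {x₀ : EuclideanSpace ℝ (Fin N)} {Q : Matrix (Fin N) (Fin N) ℝ} {R : Matrix (Fin q) (Fin q) ℝ}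
  {xd : ℝ → EuclideanSpace ℝ (Fin N)}

/-- Comparison with the zero control. The coercivity comes from `R` and not from `α`, so the
resulting constant does not degenerate for small `α`. -/
theorem norm_sq_le_of_isMinOn (hF : IsDissipativeSystem F T) (hT : 0 ≤ T) (hQ : Q.PosSemidef)
    {r : ℝ} (hr : 0 < r) (hR : ∀ v, r * ‖v‖ ^ 2 ≤ inner ℝ v (op R v))
    (hxd : MemLp xd 2 (volume.restrict (Ioc 0 T))) {u : Control T q}
    (hu : IsMinOn (cost F B x₀ Q R xd T) univ u) :
    ‖u‖ ^ 2 ≤ 2 * cost F B x₀ Q R xd T 0 / r := by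
  have h0 : cost F B x₀ Q R xd T u ≤ cost F B x₀ Q R xd T 0 := hu (mem_univ _)
  have mx : MemLp (fun t => trajectory F B x₀ T u t - xd t) 2 (volume.restrict (Ioc 0 T)) :=
    (hF.memLp_trajectory B x₀ u).sub hxd
  have h1 : ∫ t in (0 : ℝ)..T, r * ‖u t‖ ^ 2 ≤ 2 * cost F B x₀ Q R xd T u := by
    unfold cost
    rw [← mul_assoc, mul_one_div_cancel two_ne_zero, one_mul]
    refine intervalIntegral.integral_mono_on hT
      (((intervalIntegrable_iff_integrableOn_Ioc_of_le hT).2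
        (Lp.memLp u).norm.integrable_sq).const_mul _)
      ((intervalIntegrable_inner_op hT Q mx mx).add
        (intervalIntegrable_inner_op hT R (Lp.memLp u) (Lp.memLp u))) fun t _ => ?_
    have := inner_op_nonneg hQ (trajectory F B x₀ T u t - xd t)
    linarith [hR (u t)]
  rw [intervalIntegral.integral_const_mul, ← Control.norm_sq_eq hT] at h1
  rw [le_div_iff₀ hr]
  linarith

/-- Comparison of the minimizers of two cost functionals, the second of which is strongly convex. -/
theorem sq_mul_abs_cost_sub_le {F₁ : ℝ → Matrix (Fin N) (Fin N) ℝ} (hF : IsDissipativeSystem F T)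
    (hF₁ : IsDissipativeSystem F₁ T) (hT : 0 < T) (hQ : Q.PosSemidef) (hR : R.PosSemidef)
    (hxd : MemLp xd 2 (volume.restrict (Ioc 0 T))) {α E : ℝ} (hα : 0 ≤ α) (hE : 0 ≤ E)
    {u u₁ : Control T q} (hconv : StrongConvexOn univ α (cost F₁ B x₀ Q R xd T))
    (hu : IsMinOn (cost F B x₀ Q R xd T) univ u) (hu₁ : IsMinOn (cost F₁ B x₀ Q R xd T) univ u₁)
    (hD : 0 < α → ∀ v, costDeriv B x₀ Q R F₁ xd u v - costDeriv B x₀ Q R F xd u v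
      ≤ α / 2 * ‖v‖ ^ 2 + α⁻¹ * E) :
    α ^ 2 * |cost F B x₀ Q R xd T u₁ - cost F B x₀ Q R xd T u|
      ≤ (‖op Q‖ * (4 * ‖op B‖ ^ 2 * T ^ 2) + ‖op R‖) * E := by
  have hc : 0 ≤ ‖op Q‖ * (4 * ‖op B‖ ^ 2 * T ^ 2) + ‖op R‖ := by positivity
  -- For `α = 0` the left-hand side vanishes; otherwise division by `α` is allowed.
  rcases hα.eq_or_lt with rfl | hα'
  · simpa using mul_nonneg hc hE
  set w := u - u₁ with hw
  have e1 : u = u₁ + (1 : ℝ) • w := by simp [hw]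
  have e2 : u₁ = u + (-1 : ℝ) • w := by simp [hw]
  have h1 := hF₁.cost_add_smul B x₀ hT.le hQ hR hxd u₁ w 1
  have h2 := hF₁.cost_add_smul B x₀ hT.le hQ hR hxd u w (-1)
  have h3 := hF.cost_add_smul B x₀ hT.le hQ hR hxd u w (-1)
  rw [← e1, hF₁.costDeriv_eq_zero B x₀ hT.le hQ hR hxd hu₁] at h1
  rw [← e2] at h2 h3
  have hz := hF.costDeriv_eq_zero B x₀ hT.le hQ hR hxd hu w
  have h4 := hF₁.le_costHess_of_strongConvexOn B x₀ hT.le hQ hR hxd hconv w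
  have h5 := hD hα' w
  -- Adding `h1` and `h2` cancels the values of the cost and leaves twice the second-order term
  -- equal to the derivative at `u`. By `h4` it is at least `α * ‖w‖ ^ 2`, of which `h5` absorbs
  -- half.
  have h6 : α * ‖w‖ ^ 2 ≤ 2 * (α⁻¹ * E) := by linarith
  have h7 : α ^ 2 * ‖w‖ ^ 2 ≤ 2 * E := by
    calc α ^ 2 * ‖w‖ ^ 2 = α * (α * ‖w‖ ^ 2) := by ring
      _ ≤ α * (2 * (α⁻¹ * E)) := by gcongr
      _ = 2 * E := by field_simp
  have h8 : cost F B x₀ Q R xd T u₁ - cost F B x₀ Q R xd T u = costHess B Q R F w := by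
    rw [h3, hz]; ring
  rw [h8, abs_of_nonneg (costHess_nonneg B hT.le hQ hR F w)]
  have h9 := hF.costHess_le (Q := Q) (R := R) B hT w
  calc _ ≤ α ^ 2 * ((1 / 2) * (‖op Q‖ * (4 * ‖op B‖ ^ 2 * T ^ 2) + ‖op R‖) * ‖w‖ ^ 2) := by gcongr
    _ = (1 / 2) * (‖op Q‖ * (4 * ‖op B‖ ^ 2 * T ^ 2) + ‖op R‖) * (α ^ 2 * ‖w‖ ^ 2) := by ring
    _ ≤ (1 / 2) * (‖op Q‖ * (4 * ‖op B‖ ^ 2 * T ^ 2) + ‖op R‖) * (2 * E) := by gcongr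
    _ = _ := by ring

end Optimality

end RandomBatch

end

/-! ### The constant, and averaging of the pathwise estimate -/

theorem corollary3 (N q : ℕ) (T : ℝ) (hT : 0 < T)
    (A : Matrix (Fin N) (Fin N) ℝ) (B : Matrix (Fin N) (Fin q) ℝ)
    (x₀ : EuclideanSpace ℝ (Fin N))
    (Q : Matrix (Fin N) (Fin N) ℝ) (hQ : Q.PosSemidef)
    (R : Matrix (Fin q) (Fin q) ℝ) (hR : R.PosDef)
    (xd : ℝ → EuclideanSpace ℝ (Fin N))
    (hxd : MeasureTheory.MemLp xd 2 (MeasureTheory.volume.restrict (Set.Ioc 0 T))) :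
    ∃ C : ℝ, 0 ≤ C ∧
      ∀ (M : ℕ) (Asub : Fin M → Matrix (Fin N) (Fin N) ℝ) (p : Finset (Fin M) → ℝ)
        (K : ℕ) (τ : Fin (K + 1) → ℝ) (α : ℝ)
        (ustar : RandomBatch.Control T q)
        (uhstar : RandomBatch.Sample M K → RandomBatch.Control T q),
        A = ∑ m, Asub m →
        (∀ m x, inner ℝ x (RandomBatch.op (Asub m) x) ≤ 0) →
        (∀ S, 0 ≤ p S) →
        ∑ S, p S = 1 →
        (∀ m, 0 < RandomBatch.inclusionProb p m) →
        RandomBatch.IsGrid T τ →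
        0 ≤ α →
        (∀ ω, StrongConvexOn Set.univ α (RandomBatch.Jh Asub p τ B x₀ Q R xd T ω)) →
        IsMinOn (RandomBatch.J A B x₀ Q R xd T) Set.univ ustar →
        (∀ ω, IsMinOn (RandomBatch.Jh Asub p τ B x₀ Q R xd T ω) Set.univ (uhstar ω)) →
        α ^ 2 * RandomBatch.expectation p (fun ω =>
            |RandomBatch.J A B x₀ Q R xd T (uhstar ω) - RandomBatch.J A B x₀ Q R xd T ustar|)
          ≤ C * (RandomBatch.gridSpacing τ * RandomBatch.varA A Asub p) := by
  open RandomBatch in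
  obtain ⟨r, hr, hRr⟩ := exists_pos_le_inner_op hR
  -- `U` bounds `‖u*‖²`. `X` bounds the original and randomized states driven by `u*`, and `Y`
  -- bounds the corresponding adjoint states; all three are built from the data of the original
  -- problem alone.
  set U := 2 * J A B x₀ Q R xd T 0 / r with hU
  set X := ‖x₀‖ + ‖op B‖ * (T + U) with hX
  set Y := 2 * (‖op Q‖ * (T * X + ∫ t in (0 : ℝ)..T, ‖xd t‖)) with hY
  refine ⟨(‖op Q‖ * (4 * ‖op B‖ ^ 2 * T ^ 2) + ‖op R‖) *
    ((4 * ‖op B‖ ^ 2 * T ^ 2 + 1) * ‖op Q‖ ^ 2 * errorConst T ‖op A‖ X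
      + ‖op B‖ ^ 2 * errorConst T ‖op A‖ Y), ?_, ?_⟩
  · have h1 := errorConst_nonneg (X := X) hT.le (norm_nonneg (op A))
    have h2 := errorConst_nonneg (X := Y) hT.le (norm_nonneg (op A))
    positivity
  intro M Asub p K τ α u uh hA hdis hp h1 hπ hτ hα hconv hu huh
  have hAdis := inner_sum_nonpos hA hdis
  have hF := isDissipativeSystem_const hAdis hT.le
  have hF₁ := fun ω => isDissipativeSystem_randomMatrix (p := p) hdis hπ hτ ω
  have hG := isDissipativeSystem_const (inner_transpose_nonpos hAdis) hT.le
  have hdis' : ∀ m x, inner ℝ x (op (Asub m).transpose x) ≤ 0 := fun m =>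
    inner_transpose_nonpos (hdis m)
  have hG₁ := fun ω : Sample M K =>
    isDissipativeSystem_randomMatrix (p := p) hdis' hπ hτ.reverse (ω ∘ Fin.rev)
  have huU : ‖u‖ ^ 2 ≤ U := norm_sq_le_of_isMinOn hF hT.le hQ hr hRr hxd hu
  have huX : ‖x₀‖ + 2 * ∫ s in (0 : ℝ)..T, ‖op B (u s)‖ ≤ X := by
    have h2 := Control.integral_norm_op_le hT.le B u
    have h3 := Control.sq_integral_norm_le hT u
    -- With `I` the integral, `2 T I ≤ T² + I²` and `I² ≤ T ‖u‖² ≤ T U`; a factor `T` is then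
    -- cancelled.
    have h4 : 2 * ∫ t in (0 : ℝ)..T, ‖u t‖ ≤ T + U := by
      set I := ∫ t in (0 : ℝ)..T, ‖u t‖
      have h5 : 0 ≤ (I - T) ^ 2 := sq_nonneg _
      have h6 : T * (2 * I) ≤ T * (T + U) := by nlinarith
      exact le_of_mul_le_mul_left h6 hT
    have h5 := mul_le_mul_of_nonneg_left h4 (norm_nonneg (op B))
    rw [hX]; linarith
  set x := trajectory (fun _ => A) B x₀ T u with hx
  have mx : MeasureTheory.MemLp (fun t => x t - xd t) 2
      (MeasureTheory.volume.restrict (Set.Ioc 0 T)) :=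
    (hF.memLp_trajectory B x₀ u).sub hxd
  have hg : MeasureTheory.MemLp (fun t => op Q (x t - xd t)) 2
      (MeasureTheory.volume.restrict (Set.Ioc 0 T)) := (op Q).comp_memLp' mx
  have hgY : ‖(0 : EuclideanSpace ℝ (Fin N))‖
      + 2 * ∫ s in (0 : ℝ)..T, ‖op (1 : Matrix (Fin N) (Fin N) ℝ) (reversal hg s)‖ ≤ Y := by
    rw [integral_norm_reversal hT.le hg, norm_zero, zero_add, hY]
    have hi : IntervalIntegrable (fun t => ‖op Q (x t - xd t)‖) MeasureTheory.volume 0 T :=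
      (intervalIntegrable_iff_integrableOn_Ioc_of_le hT.le).2 (hg.integrable (by norm_num)).norm
    have hi' : IntervalIntegrable (fun t => ‖xd t‖) MeasureTheory.volume 0 T :=
      (intervalIntegrable_iff_integrableOn_Ioc_of_le hT.le).2 (hxd.integrable (by norm_num)).norm
    have h2 := intervalIntegral.integral_mono_on hT.le hi
      ((intervalIntegrable_const (c := X)).add hi' |>.const_mul ‖op Q‖) fun t ht => by
        refine ((op Q).le_opNorm _).trans (mul_le_mul_of_nonneg_left ?_ (norm_nonneg _))
        exact (norm_sub_le _ _).trans
          (add_le_add_left ((hF.norm_trajectory_le B x₀ hT.le u ht).trans huX) _)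
    rw [intervalIntegral.integral_const_mul, intervalIntegral.integral_add
      intervalIntegrable_const hi', intervalIntegral.integral_const, smul_eq_mul, sub_zero] at h2
    linarith
  have hE1 := expectation_integral_norm_sq_le hA hdis hp h1 hπ hτ hT.le B x₀ u huX
  have hA' : A.transpose = ∑ m, (Asub m).transpose := by rw [hA, Matrix.transpose_sum]
  have hE2 := expectation_integral_norm_sq_le hA' hdis' hp h1 hπ hτ.reverse hT.le 1 0
    (reversal hg) hgY
  -- The adjoint estimate is restated at the reversed sample, so that both errors refer to the same
  -- `ω`; transposition and reversal change neither the variance, nor the spacing, nor the norm of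
  -- `A`.
  rw [← expectation_comp_rev, varA_transpose, gridSpacing_reverseGrid, norm_op_transpose] at hE2
  have hpath := fun ω => sq_mul_abs_cost_sub_le hF (hF₁ ω) hT hQ hR.posSemidef hxd hα
    (by
      have i1 := intervalIntegral.integral_nonneg (μ := MeasureTheory.volume) hT.le fun t _ =>
        sq_nonneg ‖trajectory (randomMatrix Asub p τ ω) B x₀ T u t - x t‖
      have i2 := intervalIntegral.integral_nonneg (μ := MeasureTheory.volume) hT.le fun t _ =>
        sq_nonneg ‖trajectory (randomMatrix (fun m => (Asub m).transpose) p (reverseGrid T τ)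
          (ω ∘ Fin.rev)) 1 0 T (reversal hg) t
            - trajectory (fun _ => A.transpose) 1 0 T (reversal hg) t‖
      exact add_nonneg (mul_nonneg (by positivity) i1) (mul_nonneg (by positivity) i2))
    (hconv ω) hu (huh ω) fun hα' v =>
      costDeriv_sub_le (hF₁ ω) (hG₁ ω) hF hG hT
        ((ae_randomMatrix_reverse Asub p T τ ω).mono fun s hs _ => hs)
        (Filter.Eventually.of_forall fun _ _ => rfl) B x₀ hQ R hxd u v hg (fun _ => rfl) hα'
  have hexp := expectation_mono hp hpath
  rw [expectation_const_mul, expectation_const_mul, expectation_add, expectation_const_mul,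
    expectation_const_mul] at hexp
  refine (hexp.trans (mul_le_mul_of_nonneg_left (add_le_add
    (mul_le_mul_of_nonneg_left hE1 (by positivity))
    (mul_le_mul_of_nonneg_left hE2 (by positivity))) (by positivity))).trans (le_of_eq ?_)
  ring
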